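/- Let $M$ be a smooth manifold (compactness is not needed) with a transversely holomorphic foliation $\mathcal F$ of complex codimension $n$: an open cover $\{U_i\}$ of $M$, a complex $n$-dimensional manifold $T_0$, smooth submersions $f_i\colon U_i\to T_0$ with connected fibres, and holomorphic maps $\gamma_{ij}$ from $f_i(U_i\cap U_j)$ to $T_0$ with $f_j=\gamma_{ij}\circ f_i$ on $U_i\cap U_j$ (so $\gamma_{ij}$ is biholomorphic onto its image, with inverse $\gamma_{ji}$). For $\mathbb K\in\{\mathbb R,\mathbb C\}$ let $\Omega^k(M/\mathcal F,\mathbb K)$ be the space of basic forms, i.e. smooth $\mathbb K$-valued $k$-forms $\omega$ on $M$ with $i_X\omega=i_Xd\omega=0$ for all $X$ tangent to the leaves, and let $$H^k(M/\mathcal F,\mathbb K)=\frac{\ker\big(d\colon\Omega^k(M/\mathcal F,\mathbb K)\to\Omega^{k+1}(M/\mathcal F,\mathbb K)\big)}{d\,\Omega^{k-1}(M/\mathcal F,\mathbb K)}$$ be the basic cohomology. Let $\Omega^{p,q}(M/\mathcal F)\subset\Omega^{p+q}(M/\mathcal F,\mathbb C)$ be the space of basic forms of type $(p,q)$ with respect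 to the transverse complex structure, and write $d=\partial+\bar\partial$ with $\partial\colon\Omega^{p,q}\to\Omega^{p+1,q}$ and $\bar\partial\colon\Omega^{p,q}\to\Omega^{p,q+1}$. The basic Bott–Chern and Aeppli cohomologies are $$H^{p,q}_{BC}(M/\mathcal F)=\frac{\ker\partial\cap\ker\bar\partial\cap\Omega^{p,q}(M/\mathcal F)}{\partial\bar\partial\,\Omega^{p-1,q-1}(M/\mathcal F)},\qquad H^{p,q}_{A}(M/\mathcal F)=\frac{\ker\partial\bar\partial\cap\Omega^{p,q}(M/\mathcal F)}{\partial\,\Omega^{p-1,q}(M/\mathcal F)+\bar\partial\,\Omega^{p,q-1}(M/\mathcal F)}.$$ If $H^k(M/\mathcal F,\mathbb K)$ is infinite dimensional for some $k\ge 0$ and some $\mathbb K\in\{\mathbb R,\mathbb C\}$, then there are $p,q\ge 0$ with $p+q=k$ such that $H^{p,q}_{BC}(M/\mathcal F)$ or $H^{p,q}_{A}(M/\mathcal F)$ is infinite dimensional over $\mathbb C$. -/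

import Mathlib

open scoped Manifold ContDiff ComplexConjugate

noncomputable section

/-! ### Differential forms on a smooth manifold -/

/-- Differential `k`-forms (not necessarily smooth) on the `m`-manifold `M` with values in `𝕜`:
an alternating `ℝ`-multilinear form on every tangent space. -/
def DiffForm (m : ℕ) (M : Type*) [TopologicalSpace M]
    [ChartedSpace (EuclideanSpace ℝ (Fin m)) M] (𝕜 : Type*) [RCLike 𝕜] (k : ℕ) :=
  (x : M) → TangentSpace (𝓡 m) x [⋀^Fin k]→L[ℝ] 𝕜

namespace DiffForm

variable {m : ℕ} {M : Type*} [TopologicalSpace M] [ChartedSpace (EuclideanSpace ℝ (Fin m)) M]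
  {𝕜 : Type*} [RCLike 𝕜] {k : ℕ}

instance : AddCommGroup (DiffForm m M 𝕜 k) :=
  inferInstanceAs (AddCommGroup ((x : M) → TangentSpace (𝓡 m) x [⋀^Fin k]→L[ℝ] 𝕜))

instance : Module 𝕜 (DiffForm m M 𝕜 k) :=
  inferInstanceAs (Module 𝕜 ((x : M) → TangentSpace (𝓡 m) x [⋀^Fin k]→L[ℝ] 𝕜))

@[simp]
theorem zero_apply (x : M) : (0 : DiffForm m M 𝕜 k) x = 0 := rfl

@[simp]
theorem add_apply (α β : DiffForm m M 𝕜 k) (x : M) : (α + β) x = α x + β x := rfl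

@[simp]
theorem smul_apply (c : 𝕜) (α : DiffForm m M 𝕜 k) (x : M) : (c • α) x = c • α x := rfl

/-- The expression of a form in the chart `φ` around `x₀`: the pullback of `α` under `φ⁻¹`. -/
def inChart (α : DiffForm m M 𝕜 k) (x₀ : M) :
    EuclideanSpace ℝ (Fin m) → EuclideanSpace ℝ (Fin m) [⋀^Fin k]→L[ℝ] 𝕜 :=
  fun z ↦ (α ((extChartAt (𝓡 m) x₀).symm z)).compContinuousLinearMap
    (mfderiv (𝓡 m) (𝓡 m) (extChartAt (𝓡 m) x₀).symm z)

/-- A form is smooth if its expression in every chart is smooth. -/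
def IsSmooth (α : DiffForm m M 𝕜 k) : Prop :=
  ∀ x₀ : M, ContDiffOn ℝ ∞ (α.inChart x₀) (extChartAt (𝓡 m) x₀).target

/-- The exterior derivative: at `x`, it is computed in the chart `φ` around `x` and pulled back
by `φ`. -/
def d (α : DiffForm m M 𝕜 k) : DiffForm m M 𝕜 (k + 1) :=
  fun x ↦ (extDeriv (α.inChart x) (extChartAt (𝓡 m) x x)).compContinuousLinearMap
    (mfderiv (𝓡 m) (𝓡 m) (extChartAt (𝓡 m) x) x)

theorem inChart_add (α η : DiffForm m M 𝕜 k) (x₀ : M) :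
    inChart (α + η) x₀ = inChart α x₀ + inChart η x₀ := rfl

theorem inChart_smul (c : 𝕜) (α : DiffForm m M 𝕜 k) (x₀ : M) :
    inChart (c • α) x₀ = c • inChart α x₀ := rfl

theorem inChart_zero (x₀ : M) : inChart (0 : DiffForm m M 𝕜 k) x₀ = 0 := rfl

theorem IsSmooth.differentiableAt {α : DiffForm m M 𝕜 k} (h : IsSmooth α) (x : M) :
    DifferentiableAt ℝ (inChart α x) (extChartAt (𝓡 m) x x) :=
  ((h x).contDiffAt ((isOpen_extChartAt_target (I := 𝓡 m) x).mem_nhds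
    (mem_extChartAt_target (I := 𝓡 m) x))).differentiableAt (by simp)

theorem isSmooth_zero : IsSmooth (0 : DiffForm m M 𝕜 k) := fun x₀ ↦ by
  rw [inChart_zero]; exact contDiffOn_const

theorem IsSmooth.add {α η : DiffForm m M 𝕜 k} (h : IsSmooth α) (h' : IsSmooth η) :
    IsSmooth (α + η) := fun x₀ ↦ by
  rw [inChart_add]; exact (h x₀).add (h' x₀)

theorem IsSmooth.smul {α : DiffForm m M 𝕜 k} (c : 𝕜) (h : IsSmooth α) :
    IsSmooth (c • α) := fun x₀ ↦ by
  rw [inChart_smul]; exact (h x₀).const_smul c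

theorem d_add {α η : DiffForm m M 𝕜 k} (h : IsSmooth α) (h' : IsSmooth η) :
    d (α + η) = d α + d η := by
  funext x
  simp only [d, inChart_add, add_apply, extDeriv_add (h.differentiableAt x)
    (h'.differentiableAt x)]
  rfl

theorem d_smul {α : DiffForm m M 𝕜 k} (c : 𝕜) (h : IsSmooth α) :
    d (c • α) = c • d α := by
  have key (x : M) : extDeriv (c • inChart α x) (extChartAt (𝓡 m) x x) =
      c • extDeriv (inChart α x) (extChartAt (𝓡 m) x x) := by
    ext v
    simp only [extDeriv, fderiv_const_smul (h.differentiableAt x) c,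
      ContinuousAlternatingMap.alternatizeUncurryFin_apply, ContinuousAlternatingMap.smul_apply,
      _root_.smul_apply, Finset.smul_sum]
    exact Finset.sum_congr rfl fun i _ ↦ smul_comm _ _ _
  funext x
  simp only [d, inChart_smul, key, smul_apply]
  rfl

theorem d_zero : d (0 : DiffForm m M 𝕜 k) = 0 := by
  simpa using d_smul (0 : 𝕜) (isSmooth_zero (m := m) (M := M) (𝕜 := 𝕜) (k := k))

end DiffForm

/-! ### Transversely holomorphic foliations -/

/-- A transversely holomorphic foliation of complex codimension `n` on the smooth `m`-manifold `M`,
given by a cocycle with values in the complex `n`-manifold `T₀`: an open cover `U i`, submersions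
`f i` from `U i` to `T₀` with connected fibres, and holomorphic changes of transverse coordinates
`γ i j` with `f j = γ i j ∘ f i` on `U i ∩ U j`. The values of `f i` outside `U i`, and of
`γ i j` outside the open set `f i (U i ∩ U j)`, are irrelevant; on these sets `γ i j` and `γ j i`
are inverse to each other, so that `γ i j` is biholomorphic there. -/
structure TransverselyHolomorphicFoliation (m n : ℕ) (M T₀ ι : Type*)
    [TopologicalSpace M] [ChartedSpace (EuclideanSpace ℝ (Fin m)) M]
    [TopologicalSpace T₀] [ChartedSpace (EuclideanSpace ℂ (Fin n)) T₀] where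
  U : ι → Set M
  isOpen_U : ∀ i, IsOpen (U i)
  cover : ⋃ i, U i = Set.univ
  f : ι → M → T₀
  submersion : ∀ i, ∀ x ∈ U i,
    Manifold.IsSubmersionAt (𝓡 m) 𝓘(ℝ, EuclideanSpace ℂ (Fin n)) ∞ (f i) x
  connected_fibres : ∀ i, ∀ y ∈ f i '' U i, IsConnected (U i ∩ f i ⁻¹' {y})
  γ : ι → ι → T₀ → T₀
  holomorphic : ∀ i j, ∀ y ∈ f i '' (U i ∩ U j),
    MDifferentiableAt 𝓘(ℂ, EuclideanSpace ℂ (Fin n)) 𝓘(ℂ, EuclideanSpace ℂ (Fin n)) (γ i j) y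
  cocycle : ∀ i j, ∀ x ∈ U i ∩ U j, f j x = γ i j (f i x)

namespace TransverselyHolomorphicFoliation

variable {m n : ℕ} {M T₀ ι : Type*}
  [TopologicalSpace M] [ChartedSpace (EuclideanSpace ℝ (Fin m)) M]
  [TopologicalSpace T₀] [ChartedSpace (EuclideanSpace ℂ (Fin n)) T₀]

/-- The differential of `f i` at `x`, with values in the complex vector space `T_{f i x} T₀ = ℂⁿ`. -/
def df (F : TransverselyHolomorphicFoliation m n M T₀ ι) (i : ι) (x : M) :
    TangentSpace (𝓡 m) x →L[ℝ] EuclideanSpace ℂ (Fin n) :=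
  mfderiv (𝓡 m) 𝓘(ℝ, EuclideanSpace ℂ (Fin n)) (F.f i) x

/-- A tangent vector is tangent to the leaves if it is killed by the differentials of the
submersions defining the foliation. -/
def IsTangent (F : TransverselyHolomorphicFoliation m n M T₀ ι) (x : M)
    (v : TangentSpace (𝓡 m) x) : Prop :=
  ∀ i, x ∈ F.U i → F.df i x v = 0

/-- `i_X α = 0` for all `X` tangent to the leaves: `α` vanishes as soon as one of its arguments is
tangent to the leaves. -/
def IsHorizontal (F : TransverselyHolomorphicFoliation m n M T₀ ι) {𝕜 : Type*} [RCLike 𝕜] {k : ℕ}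
    (α : DiffForm m M 𝕜 k) : Prop :=
  ∀ (x : M) (v : Fin k → TangentSpace (𝓡 m) x) (j : Fin k), F.IsTangent x (v j) → α x v = 0

/-- The space `Ω^k(M/F, 𝕜)` of basic forms: smooth forms `α` with `i_X α = i_X dα = 0` for all `X`
tangent to the leaves. -/
def basicForms (F : TransverselyHolomorphicFoliation m n M T₀ ι) (𝕜 : Type*) [RCLike 𝕜] (k : ℕ) :
    Submodule 𝕜 (DiffForm m M 𝕜 k) where
  carrier := {α | α.IsSmooth ∧ F.IsHorizontal α ∧ F.IsHorizontal α.d}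
  zero_mem' := ⟨DiffForm.isSmooth_zero, fun _ _ _ _ ↦ rfl, by
    rw [DiffForm.d_zero]; exact fun _ _ _ _ ↦ rfl⟩
  add_mem' := fun {a b} ha hb ↦ ⟨ha.1.add hb.1, fun x v j h ↦ by
      simp [ha.2.1 x v j h, hb.2.1 x v j h], fun x v j h ↦ by
      simp [DiffForm.d_add ha.1 hb.1, ha.2.2 x v j h, hb.2.2 x v j h]⟩
  smul_mem' := fun c a ha ↦ ⟨ha.1.smul c, fun x v j h ↦ by simp [ha.2.1 x v j h], fun x v j h ↦ by
      simp [DiffForm.d_smul c ha.1, ha.2.2 x v j h]⟩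

/-! ### Basic de Rham cohomology -/

/-- Closed basic forms. -/
def closedForms (F : TransverselyHolomorphicFoliation m n M T₀ ι) (𝕜 : Type*) [RCLike 𝕜] (k : ℕ) :
    Submodule 𝕜 (DiffForm m M 𝕜 k) where
  carrier := {α | α ∈ F.basicForms 𝕜 k ∧ α.d = 0}
  zero_mem' := ⟨zero_mem _, DiffForm.d_zero⟩
  add_mem' := fun ha hb ↦ ⟨add_mem ha.1 hb.1, by
    rw [DiffForm.d_add ha.1.1 hb.1.1, ha.2, hb.2, add_zero]⟩
  smul_mem' := fun c _ ha ↦ ⟨Submodule.smul_mem _ c ha.1, by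
    rw [DiffForm.d_smul c ha.1.1, ha.2, smul_zero]⟩

/-- Exact basic forms: the image of `d` on basic forms. -/
def exactForms (F : TransverselyHolomorphicFoliation m n M T₀ ι) (𝕜 : Type*) [RCLike 𝕜] :
    (k : ℕ) → Submodule 𝕜 (DiffForm m M 𝕜 k)
  | 0 => ⊥
  | k + 1 =>
    { carrier := {η | ∃ α ∈ F.basicForms 𝕜 k, α.d = η}
      zero_mem' := ⟨0, zero_mem _, DiffForm.d_zero⟩
      add_mem' := by
        rintro _ _ ⟨a, ha, rfl⟩ ⟨b, hb, rfl⟩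
        exact ⟨a + b, add_mem ha hb, DiffForm.d_add ha.1 hb.1⟩
      smul_mem' := by
        rintro c _ ⟨a, ha, rfl⟩
        exact ⟨c • a, Submodule.smul_mem _ c ha, DiffForm.d_smul c ha.1⟩ }

/-- The basic cohomology `H^k(M/F)` with coefficients in `𝕜`. -/
abbrev BasicCohomology (F : TransverselyHolomorphicFoliation m n M T₀ ι) (𝕜 : Type*) [RCLike 𝕜]
    (k : ℕ) :=
  F.closedForms 𝕜 k ⧸ (F.exactForms 𝕜 k).submoduleOf (F.closedForms 𝕜 k)

/-! ### The bigrading and the operators `∂` and `∂̄` -/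

/-- The space `Ω^{p,q}(M/F)` of basic `k`-forms of type `(p,q)`. A basic form `α` is, at each point
`x` of `U i`, the pullback under `df i` of an alternating form `β` on the complex vector space
`T_{f i x} T₀`; it is of type `(p,q)` if `β` is, that is, if
`β (c u₁, …, c u_k) = c ^ p * (conj c) ^ q * β (u₁, …, u_k)` for all complex numbers `c`.
This space is zero unless `p + q = k`. -/
def typeForms (F : TransverselyHolomorphicFoliation m n M T₀ ι) (k p q : ℕ) :
    Submodule ℂ (DiffForm m M ℂ k) where
  carrier := {α | α ∈ F.basicForms ℂ k ∧
    ∀ (i : ι), ∀ x ∈ F.U i, ∀ (c : ℂ) (v w : Fin k → TangentSpace (𝓡 m) x),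
      (∀ j, F.df i x (w j) = c • F.df i x (v j)) → α x w = c ^ p * conj c ^ q * α x v}
  zero_mem' := ⟨zero_mem _, fun _ _ _ _ _ _ _ ↦ by simp⟩
  add_mem' := fun ha hb ↦ ⟨add_mem ha.1 hb.1, fun i x hx c v w h ↦ by
    simp [ha.2 i x hx c v w h, hb.2 i x hx c v w h, mul_add]⟩
  smul_mem' := fun c _ ha ↦ ⟨Submodule.smul_mem _ c ha.1, fun i x hx c v w h ↦ by
    simp [ha.2 i x hx c v w h, mul_left_comm]⟩

/-- The graph of `∂ : Ω^{p,q} → Ω^{p+1,q}`: `η = ∂α` is the component of type `(p+1,q)` of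
`dα = ∂α + ∂̄α`, the other component having type `(p,q+1)`. -/
def delGraph (F : TransverselyHolomorphicFoliation m n M T₀ ι) (k p q : ℕ) :
    Submodule ℂ (DiffForm m M ℂ k × DiffForm m M ℂ (k + 1)) where
  carrier := {a | a.1 ∈ F.typeForms k p q ∧ a.2 ∈ F.typeForms (k + 1) (p + 1) q ∧
    a.1.d - a.2 ∈ F.typeForms (k + 1) p (q + 1)}
  zero_mem' := ⟨zero_mem _, zero_mem _, by simp [DiffForm.d_zero, zero_mem]⟩
  add_mem' := fun {a b} ha hb ↦ ⟨add_mem ha.1 hb.1, add_mem ha.2.1 hb.2.1, by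
    have := add_mem ha.2.2 hb.2.2
    rwa [sub_add_sub_comm, ← DiffForm.d_add ha.1.1.1 hb.1.1.1] at this⟩
  smul_mem' := fun c a ha ↦ ⟨Submodule.smul_mem _ c ha.1, Submodule.smul_mem _ c ha.2.1, by
    have := Submodule.smul_mem _ c ha.2.2
    rwa [smul_sub, ← DiffForm.d_smul c ha.1.1.1] at this⟩

/-- The graph of `∂̄ : Ω^{p,q} → Ω^{p,q+1}`: `ζ = ∂̄α` is the component of type `(p,q+1)` of
`dα = ∂α + ∂̄α`, the other component having type `(p+1,q)`. -/
def delbarGraph (F : TransverselyHolomorphicFoliation m n M T₀ ι) (k p q : ℕ) :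
    Submodule ℂ (DiffForm m M ℂ k × DiffForm m M ℂ (k + 1)) where
  carrier := {a | a.1 ∈ F.typeForms k p q ∧ a.2 ∈ F.typeForms (k + 1) p (q + 1) ∧
    a.1.d - a.2 ∈ F.typeForms (k + 1) (p + 1) q}
  zero_mem' := ⟨zero_mem _, zero_mem _, by simp [DiffForm.d_zero, zero_mem]⟩
  add_mem' := fun {a b} ha hb ↦ ⟨add_mem ha.1 hb.1, add_mem ha.2.1 hb.2.1, by
    have := add_mem ha.2.2 hb.2.2
    rwa [sub_add_sub_comm, ← DiffForm.d_add ha.1.1.1 hb.1.1.1] at this⟩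
  smul_mem' := fun c a ha ↦ ⟨Submodule.smul_mem _ c ha.1, Submodule.smul_mem _ c ha.2.1, by
    have := Submodule.smul_mem _ c ha.2.2
    rwa [smul_sub, ← DiffForm.d_smul c ha.1.1.1] at this⟩

/-- The graph of `∂∂̄ : Ω^{p,q} → Ω^{p+1,q+1}`. -/
def delDelbarGraph (F : TransverselyHolomorphicFoliation m n M T₀ ι) (k p q : ℕ) :
    Submodule ℂ (DiffForm m M ℂ k × DiffForm m M ℂ (k + 2)) where
  carrier := {a | ∃ ζ, (a.1, ζ) ∈ F.delbarGraph k p q ∧ (ζ, a.2) ∈ F.delGraph (k + 1) p (q + 1)}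
  zero_mem' := ⟨0, zero_mem (F.delbarGraph k p q), zero_mem (F.delGraph (k + 1) p (q + 1))⟩
  add_mem' := by
    rintro a b ⟨ζ, h₁, h₂⟩ ⟨ζ', h₁', h₂'⟩
    exact ⟨ζ + ζ', add_mem h₁ h₁', add_mem h₂ h₂'⟩
  smul_mem' := by
    rintro c a ⟨ζ, h₁, h₂⟩
    exact ⟨c • ζ, Submodule.smul_mem _ c h₁, Submodule.smul_mem _ c h₂⟩

/-- The kernel of a linear operator given by its graph. -/
def graphKer {V W : Type*} [AddCommGroup V] [Module ℂ V] [AddCommGroup W] [Module ℂ W]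
    (G : Submodule ℂ (V × W)) : Submodule ℂ V :=
  G.comap (LinearMap.inl ℂ V W)

/-- The image of a linear operator given by its graph. -/
def graphIm {V W : Type*} [AddCommGroup V] [Module ℂ V] [AddCommGroup W] [Module ℂ W]
    (G : Submodule ℂ (V × W)) : Submodule ℂ W :=
  G.map (LinearMap.snd ℂ V W)

/-- `im ∂ ∩ Ω^{p,q}`, the image of `∂ : Ω^{p-1,q} → Ω^{p,q}`. -/
def imDel (F : TransverselyHolomorphicFoliation m n M T₀ ι) :
    (k p q : ℕ) → Submodule ℂ (DiffForm m M ℂ k)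
  | k + 1, p + 1, q => graphIm (F.delGraph k p q)
  | _, _, _ => ⊥

/-- `im ∂̄ ∩ Ω^{p,q}`, the image of `∂̄ : Ω^{p,q-1} → Ω^{p,q}`. -/
def imDelbar (F : TransverselyHolomorphicFoliation m n M T₀ ι) :
    (k p q : ℕ) → Submodule ℂ (DiffForm m M ℂ k)
  | k + 1, p, q + 1 => graphIm (F.delbarGraph k p q)
  | _, _, _ => ⊥

/-- `im ∂∂̄ ∩ Ω^{p,q}`, the image of `∂∂̄ : Ω^{p-1,q-1} → Ω^{p,q}`. -/
def imDelDelbar (F : TransverselyHolomorphicFoliation m n M T₀ ι) :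
    (k p q : ℕ) → Submodule ℂ (DiffForm m M ℂ k)
  | k + 2, p + 1, q + 1 => graphIm (F.delDelbarGraph k p q)
  | _, _, _ => ⊥

/-! ### Basic Bott–Chern and Aeppli cohomology -/

/-- `ker ∂ ∩ ker ∂̄ ∩ Ω^{p,q}`. -/
def bottChernCocycles (F : TransverselyHolomorphicFoliation m n M T₀ ι) (k p q : ℕ) :
    Submodule ℂ (DiffForm m M ℂ k) :=
  graphKer (F.delGraph k p q) ⊓ graphKer (F.delbarGraph k p q)

/-- `ker ∂∂̄ ∩ Ω^{p,q}`. -/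
def aeppliCocycles (F : TransverselyHolomorphicFoliation m n M T₀ ι) (k p q : ℕ) :
    Submodule ℂ (DiffForm m M ℂ k) :=
  graphKer (F.delDelbarGraph k p q)

/-- The basic Bott–Chern cohomology
`H^{p,q}_{BC}(M/F) = (ker ∂ ∩ ker ∂̄ ∩ Ω^{p,q}) / (im ∂∂̄ ∩ Ω^{p,q})`. -/
abbrev BottChernCohomology (F : TransverselyHolomorphicFoliation m n M T₀ ι) (p q : ℕ) :=
  F.bottChernCocycles (p + q) p q ⧸
    (F.imDelDelbar (p + q) p q).submoduleOf (F.bottChernCocycles (p + q) p q)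

/-- The basic Aeppli cohomology
`H^{p,q}_A(M/F) = (ker ∂∂̄ ∩ Ω^{p,q}) / ((im ∂ + im ∂̄) ∩ Ω^{p,q})`. -/
abbrev AeppliCohomology (F : TransverselyHolomorphicFoliation m n M T₀ ι) (p q : ℕ) :=
  F.aeppliCocycles (p + q) p q ⧸
    (F.imDel (p + q) p q ⊔ F.imDelbar (p + q) p q).submoduleOf (F.aeppliCocycles (p + q) p q)

end TransverselyHolomorphicFoliation

end

/-! In each total degree `k` the sequence `⊕ H_BC^{p,q} → H^k → ⊕ H_A^{p,q}`, with sums over `p + q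
= k`, is exact in the middle. Finite dimension of the outer terms therefore forces finite dimension
of `H^k`, and the theorem is the contrapositive. The argument is purely algebraic once `d = ∂ + ∂̄`
is available on basic forms; no ellipticity or compactness enters.

The second map takes components: if `dα = 0`, then `∂̄α_p = -∂α_{p-1}`, so `∂∂̄α_p = 0`
(`closedForms_le_iSup_aeppliCocycles`). For exactness, let every component of a closed `α` lie in
`im ∂ + im ∂̄`. As `∂a = da - ∂̄a`, the form `α` is a sum of forms `∂̄a_r` up to an exact form. The
forms `d∂̄a_r = ∂∂̄a_r` have pairwise different types and sum to zero, so each vanishes, and each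
`∂̄a_r` is a Bott–Chern cocycle (`closedForms_inf_le`). Finally `∂∂̄a = d∂̄a` is exact
(`imDelDelbar_le_exactForms`). For other coefficients, `H^k(𝕜)` is a real-linear retract of
`H^k(ℂ)`.

Most of the work is the decomposition of basic forms by type. For a horizontal form, `c ↦ β (c v)`
is a polynomial in `c` and `conj c`, and its coefficients, the components, are recovered by
interpolation. In a parametrization by `ℂⁿ × C` in which the leaves are vertical, the projection to
a component is a constant linear operator, so it preserves smoothness and commutes with derivatives
(`pullback_typeComponent`). There, basic means horizontal with vanishing vertical derivatives, and
the types that occur in `dα` can be read off (`typeComponent_extDeriv_eq_zero`). -/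

noncomputable section

/-! ### Smoothness of pullbacks of alternating forms -/

section AlternatingPullback

variable {E F G W : Type*} [NormedAddCommGroup E] [NormedSpace ℝ E]
  [NormedAddCommGroup F] [NormedSpace ℝ F] [NormedAddCommGroup G] [NormedSpace ℝ G]
  [NormedAddCommGroup W] [NormedSpace ℝ W] {k : ℕ}

/-- The alternatization of multilinear maps as a continuous linear map. -/
def alternatizationCLM (E G : Type*) [NormedAddCommGroup E] [NormedSpace ℝ E]
    [NormedAddCommGroup G] [NormedSpace ℝ G] (k : ℕ) :
    ContinuousMultilinearMap ℝ (fun _ : Fin k ↦ E) G →L[ℝ] E [⋀^Fin k]→L[ℝ] G :=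
  LinearMap.mkContinuous
    { toFun := fun f ↦ ContinuousMultilinearMap.alternatization f
      map_add' := fun f g ↦ map_add _ f g
      map_smul' := fun c f ↦ by
        ext v
        simp [ContinuousMultilinearMap.alternatization_apply_apply, Finset.smul_sum,
          smul_comm c] }
    (Nat.factorial k) (fun f ↦ by
      refine ContinuousAlternatingMap.opNorm_le_bound _ (by positivity) fun v ↦ ?_
      simp only [LinearMap.coe_mk, AddHom.coe_mk,
        ContinuousMultilinearMap.alternatization_apply_apply]
      refine (norm_sum_le_of_le _ (f := fun σ : Equiv.Perm (Fin k) ↦ Equiv.Perm.sign σ • f (v ∘ σ))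
        (n := fun _ ↦ ‖f‖ * ∏ i, ‖v i‖) fun σ _ ↦ ?_).trans_eq ?_
      · have h : ‖Equiv.Perm.sign σ • f (v ∘ σ)‖ = ‖f (v ∘ σ)‖ := by
          rcases Int.units_eq_one_or (Equiv.Perm.sign σ) with h | h <;> simp [h, Units.smul_def]
        rw [h]
        refine (f.le_opNorm _).trans_eq ?_
        rw [← Equiv.prod_comp σ (fun i ↦ ‖v i‖)]
        rfl
      · simp [Fintype.card_perm, mul_assoc])

theorem alternatizationCLM_toContinuousMultilinearMap (f : E [⋀^Fin k]→L[ℝ] G) :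
    alternatizationCLM E G k f.toContinuousMultilinearMap = (Nat.factorial k : ℝ) • f := by
  ext v
  have h (σ : Equiv.Perm (Fin k)) : Equiv.Perm.sign σ • f (v ∘ σ) = f v := by
    have h := f.toAlternatingMap.map_perm v σ
    simp only [ContinuousAlternatingMap.coe_toAlternatingMap] at h
    rw [h, smul_smul]
    simp
  change ContinuousMultilinearMap.alternatization f.toContinuousMultilinearMap v = _
  rw [ContinuousMultilinearMap.alternatization_apply_apply]
  simp [h, Fintype.card_perm, ← Nat.cast_smul_eq_nsmul ℝ]

/-- For multilinear maps the pullback is itself continuous multilinear in the linear maps, hence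
smooth in them. Alternatizing and dividing by `k!` carries this back to alternating maps. -/
theorem ContDiffAt.continuousAlternatingMapCompContinuousLinearMap {r : WithTop ℕ∞}
    {f : W → F [⋀^Fin k]→L[ℝ] G} {g : W → E →L[ℝ] F} {z : W}
    (hf : ContDiffAt ℝ r f z) (hg : ContDiffAt ℝ r g z) :
    ContDiffAt ℝ r (fun y ↦ (f y).compContinuousLinearMap (g y)) z := by
  have h₁ : ContDiffAt ℝ r (fun y ↦ (f y).toContinuousMultilinearMap) z :=
    (ContinuousAlternatingMap.toContinuousMultilinearMapCLM ℝ :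
      (F [⋀^Fin k]→L[ℝ] G) →L[ℝ] _).contDiff.contDiffAt.comp z hf
  have h₂ : ContDiffAt ℝ r (fun y ↦
      (ContinuousMultilinearMap.compContinuousLinearMapContinuousMultilinear ℝ
        (fun _ : Fin k ↦ E) (fun _ ↦ F) G (fun _ ↦ g y)) (f y).toContinuousMultilinearMap) z :=
    ((ContinuousMultilinearMap.contDiff _).contDiffAt.comp z
      (contDiffAt_pi.2 fun _ ↦ hg)).clm_apply h₁
  have h₃ := ((alternatizationCLM E G k).contDiff.contDiffAt.comp z h₂).const_smul
    ((Nat.factorial k : ℝ)⁻¹)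
  refine h₃.congr_of_eventuallyEq (Filter.Eventually.of_forall fun y ↦ ?_)
  have h₄ := alternatizationCLM_toContinuousMultilinearMap ((f y).compContinuousLinearMap (g y))
  have h₅ : (Nat.factorial k : ℝ) ≠ 0 := by positivity
  calc _ = ((Nat.factorial k : ℝ)⁻¹) • (Nat.factorial k : ℝ) •
        (f y).compContinuousLinearMap (g y) := by rw [smul_smul, inv_mul_cancel₀ h₅, one_smul]
    _ = _ := by rw [← h₄]; rfl

theorem ContDiffAt.extDeriv {f : W → W [⋀^Fin k]→L[ℝ] G} {z : W} (hf : ContDiffAt ℝ ∞ f z) :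
    ContDiffAt ℝ ∞ (extDeriv f) z :=
  (ContinuousAlternatingMap.alternatizeUncurryFinCLM ℝ W G).contDiff.contDiffAt.comp z
    (hf.fderiv_right (by simp))

end AlternatingPullback

/-! ### Pullbacks of forms on `M` and the exterior derivative -/

namespace DiffForm

variable {m : ℕ} {M : Type*} [TopologicalSpace M] [ChartedSpace (EuclideanSpace ℝ (Fin m)) M]
  {𝕜 : Type*} [RCLike 𝕜] {k : ℕ}
  {V W : Type*} [NormedAddCommGroup V] [NormedSpace ℝ V] [NormedAddCommGroup W] [NormedSpace ℝ W]

/-- The pullback of a form on `M` under a map from a normed space to `M`. -/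
def pullback (α : DiffForm m M 𝕜 k) (σ : W → M) : W → W [⋀^Fin k]→L[ℝ] 𝕜 :=
  fun z ↦ (α (σ z)).compContinuousLinearMap (mfderiv 𝓘(ℝ, W) (𝓡 m) σ z)

theorem pullback_apply (α : DiffForm m M 𝕜 k) (σ : W → M) (z : W) (v : Fin k → W) :
    α.pullback σ z v = α (σ z) (fun j ↦ mfderiv 𝓘(ℝ, W) (𝓡 m) σ z (v j)) := rfl

theorem pullback_extChartAt_symm (α : DiffForm m M 𝕜 k) (x : M) :
    α.pullback (extChartAt (𝓡 m) x).symm = α.inChart x := rfl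

theorem pullback_congr (α : DiffForm m M 𝕜 k) {σ τ : W → M} {z : W}
    (h : σ =ᶠ[nhds z] τ) : α.pullback σ z = α.pullback τ z := by
  have h₁ : σ z = τ z := h.self_of_nhds
  have h₂ := h.mfderiv_eq (I := 𝓘(ℝ, W)) (I' := 𝓡 m)
  ext v
  simp only [pullback_apply]
  have h₃ (v : Fin k → EuclideanSpace ℝ (Fin m)) : α (σ z) v = α (τ z) v := by rw [h₁]
  rw [h₂]
  exact h₃ _

theorem pullback_comp (α : DiffForm m M 𝕜 k) {σ : W → M} {g : V → W} {z : V}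
    (hσ : MDifferentiableAt 𝓘(ℝ, W) (𝓡 m) σ (g z)) (hg : DifferentiableAt ℝ g z) :
    α.pullback (σ ∘ g) z = (α.pullback σ (g z)).compContinuousLinearMap (fderiv ℝ g z) := by
  ext v
  simp only [pullback_apply, ContinuousAlternatingMap.compContinuousLinearMap_apply]
  rw [mfderiv_comp z hσ hg.mdifferentiableAt, mfderiv_eq_fderiv]
  rfl

variable [IsManifold (𝓡 m) ∞ M]

/-- Factoring `σ` through the chart at `σ z` turns the pullback into one between normed spaces,
where `extDeriv_pullback` applies. -/
theorem pullback_eventuallyEq (α : DiffForm m M 𝕜 k) {σ : W → M} {z : W}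
    (hσ : ContMDiffAt 𝓘(ℝ, W) (𝓡 m) ∞ σ z) :
    ContDiffAt ℝ ∞ (extChartAt (𝓡 m) (σ z) ∘ σ) z ∧
    α.pullback σ =ᶠ[nhds z] fun y ↦
      (α.inChart (σ z) ((extChartAt (𝓡 m) (σ z) ∘ σ) y)).compContinuousLinearMap
        (fderiv ℝ (extChartAt (𝓡 m) (σ z) ∘ σ) y) := by
  have hg : ContDiffAt ℝ ∞ (extChartAt (𝓡 m) (σ z) ∘ σ) z :=
    ((contMDiffAt_extChartAt (n := ∞) (I := 𝓡 m) (x := σ z)).comp z hσ).contDiffAt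
  have h₁ : ∀ᶠ y in nhds z, σ y ∈ (extChartAt (𝓡 m) (σ z)).source :=
    hσ.continuousAt.eventually (extChartAt_source_mem_nhds (I := 𝓡 m) (σ z))
  refine ⟨hg, ?_⟩
  filter_upwards [h₁.eventually_nhds, (hg.of_le (m := 1) (by simp)).eventually (by simp)]
    with y hy hgy
  have hy' := hy.self_of_nhds
  rw [← pullback_extChartAt_symm, ← pullback_comp]
  · refine α.pullback_congr ?_
    filter_upwards [hy] with w hw
    exact ((extChartAt (𝓡 m) (σ z)).left_inv hw).symm
  · refine ((contMDiffOn_extChartAt_symm (n := ∞) (I := 𝓡 m) (σ z)).contMDiffAt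
      ((isOpen_extChartAt_target (I := 𝓡 m) (σ z)).mem_nhds
        ((extChartAt (𝓡 m) (σ z)).map_source hy'))).mdifferentiableAt (by simp)
  · exact hgy.differentiableAt (by simp)

theorem IsSmooth.contDiffAt_pullback {α : DiffForm m M 𝕜 k} (hα : α.IsSmooth) {σ : W → M} {z : W}
    (hσ : ContMDiffAt 𝓘(ℝ, W) (𝓡 m) ∞ σ z) : ContDiffAt ℝ ∞ (α.pullback σ) z := by
  obtain ⟨hg, h⟩ := α.pullback_eventuallyEq hσ
  refine ContDiffAt.congr_of_eventuallyEq ?_ h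
  refine ContDiffAt.continuousAlternatingMapCompContinuousLinearMap ?_ (hg.fderiv_right (by simp))
  exact (((hα (σ z)).contDiffAt ((isOpen_extChartAt_target (I := 𝓡 m) (σ z)).mem_nhds
    (mem_extChartAt_target (I := 𝓡 m) (σ z))))).comp z hg

/-- The exterior derivative commutes with pullbacks. -/
theorem IsSmooth.pullback_d {α : DiffForm m M 𝕜 k} (hα : α.IsSmooth) {σ : W → M} {z : W}
    (hσ : ContMDiffAt 𝓘(ℝ, W) (𝓡 m) ∞ σ z) : α.d.pullback σ z = extDeriv (α.pullback σ) z := by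
  obtain ⟨hg, h⟩ := α.pullback_eventuallyEq hσ
  rw [h.extDeriv_eq, extDeriv_pullback (r := ∞) (f := extChartAt (𝓡 m) (σ z) ∘ σ)
    (hα.differentiableAt (σ z)) hg
    (minSmoothness_of_isRCLikeNormedField.le.trans (WithTop.coe_le_coe.2 le_top))]
  ext v
  simp only [pullback_apply, d, ContinuousAlternatingMap.compContinuousLinearMap_apply]
  rw [← mfderiv_eq_fderiv, mfderiv_comp z
    ((contMDiffAt_extChartAt (n := ∞) (I := 𝓡 m) (x := σ z)).mdifferentiableAt (by simp))
    (hσ.mdifferentiableAt (by simp))]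
  rfl

theorem contMDiffAt_extChartAt_symm {x₀ : M} {z : EuclideanSpace ℝ (Fin m)}
    (hz : z ∈ (extChartAt (𝓡 m) x₀).target) :
    ContMDiffAt (𝓡 m) (𝓡 m) ∞ (extChartAt (𝓡 m) x₀).symm z :=
  (contMDiffOn_extChartAt_symm (n := ∞) (I := 𝓡 m) x₀).contMDiffAt
    ((isOpen_extChartAt_target (I := 𝓡 m) x₀).mem_nhds hz)

/-- The form `α.d` is computed at each point in that point's own chart. Applied to the inverse of
one fixed chart, `pullback_d` shows that it agrees with `extDeriv` throughout this chart. -/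
theorem IsSmooth.d {α : DiffForm m M 𝕜 k} (hα : α.IsSmooth) : α.d.IsSmooth := by
  intro x₀ z hz
  have hz' := (isOpen_extChartAt_target (I := 𝓡 m) x₀).mem_nhds hz
  refine ContDiffAt.contDiffWithinAt ?_
  refine ((hα x₀).contDiffAt hz').extDeriv.congr_of_eventuallyEq ?_
  filter_upwards [hz'] with y hy
  exact hα.pullback_d (contMDiffAt_extChartAt_symm hy)

theorem IsSmooth.d_d {α : DiffForm m M 𝕜 k} (hα : α.IsSmooth) : α.d.d = 0 := by
  funext x
  have h : extDeriv (α.d.inChart x) (extChartAt (𝓡 m) x x) = 0 := by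
    have hx := (isOpen_extChartAt_target (I := 𝓡 m) x).mem_nhds
      (mem_extChartAt_target (I := 𝓡 m) x)
    have h₁ : α.d.inChart x =ᶠ[nhds (extChartAt (𝓡 m) x x)] extDeriv (α.inChart x) := by
      filter_upwards [hx] with y hy
      exact hα.pullback_d (contMDiffAt_extChartAt_symm hy)
    rw [h₁.extDeriv_eq]
    exact extDeriv_extDeriv_apply ((hα x).contDiffAt hx)
      (minSmoothness_of_isRCLikeNormedField.le.trans (WithTop.coe_le_coe.2 le_top))
  change (extDeriv (α.d.inChart x) (extChartAt (𝓡 m) x x)).compContinuousLinearMap _ = 0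
  rw [h]
  rfl

/-- A form is smooth if near every point it has a smooth pullback under a local
parametrization. -/
theorem isSmooth_of_pullback {α : DiffForm m M 𝕜 k}
    (h : ∀ x : M, ∃ (C : Type) (_ : NormedAddCommGroup C) (_ : NormedSpace ℝ C) (σ : C → M)
      (τ : M → C), ContMDiffAt (𝓡 m) 𝓘(ℝ, C) ∞ τ x ∧
      (∀ᶠ z in nhds (τ x), ContMDiffAt 𝓘(ℝ, C) (𝓡 m) ∞ σ z) ∧
      (∀ᶠ y in nhds x, σ (τ y) = y) ∧ ContDiffAt ℝ ∞ (α.pullback σ) (τ x)) : α.IsSmooth := by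
  intro x₀ z hz
  refine ContDiffAt.contDiffWithinAt ?_
  set e := (extChartAt (𝓡 m) x₀).symm with he
  have hez : ContMDiffAt (𝓡 m) (𝓡 m) ∞ e z := contMDiffAt_extChartAt_symm hz
  obtain ⟨C, _, _, σ, τ, hτ, hσ, hστ, hα⟩ := h (e z)
  have hg : ContDiffAt ℝ ∞ (τ ∘ e) z := (hτ.comp z hez).contDiffAt
  have h₁ : α.inChart x₀ =ᶠ[nhds z] fun y ↦
      (α.pullback σ ((τ ∘ e) y)).compContinuousLinearMap (fderiv ℝ (τ ∘ e) y) := by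
    filter_upwards [(hez.continuousAt.eventually hστ).eventually_nhds,
      (hg.of_le (m := 1) (by simp)).eventually (by simp), hg.continuousAt.eventually hσ]
      with y hy hgy hσy
    rw [← pullback_comp _ (hσy.mdifferentiableAt (by simp)) (hgy.differentiableAt (by simp)),
      ← pullback_extChartAt_symm]
    refine α.pullback_congr ?_
    filter_upwards [hy] with w hw
    exact hw.symm
  refine ContDiffAt.congr_of_eventuallyEq ?_ h₁
  exact ContDiffAt.continuousAlternatingMapCompContinuousLinearMap 
    (ContDiffAt.comp (g := α.pullback σ) z hα hg) (hg.fderiv_right (by simp))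

end DiffForm

/-! ### Homogeneous polynomials in `c` and `conj c` -/

/-- Functions of the form `c ↦ ∑ b p * c ^ p * conj c ^ (k - p)`. -/
def IsBihomogeneous (k : ℕ) (g : ℂ → ℂ) : Prop :=
  ∃ b : ℕ → ℂ, ∀ c, g c = ∑ p ∈ Finset.range (k + 1), b p * (c ^ p * conj c ^ (k - p))

namespace IsBihomogeneous

variable {k : ℕ} {g h : ℂ → ℂ}

theorem add (hg : IsBihomogeneous k g) (hh : IsBihomogeneous k h) :
    IsBihomogeneous k (fun c ↦ g c + h c) := by
  obtain ⟨a, ha⟩ := hg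
  obtain ⟨b, hb⟩ := hh
  exact ⟨a + b, fun c ↦ by simp [ha, hb, add_mul, Finset.sum_add_distrib]⟩

theorem const_mul (a : ℂ) (hg : IsBihomogeneous k g) : IsBihomogeneous k (fun c ↦ a * g c) := by
  obtain ⟨b, hb⟩ := hg
  exact ⟨fun p ↦ a * b p, fun c ↦ by simp [hb, Finset.mul_sum, mul_assoc]⟩

theorem sum {ι : Type*} (s : Finset ι) {f : ι → ℂ → ℂ} (hf : ∀ i ∈ s, IsBihomogeneous k (f i)) :
    IsBihomogeneous k (fun c ↦ ∑ i ∈ s, f i c) := by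
  classical
  induction s using Finset.induction_on with
  | empty => exact ⟨0, fun c ↦ by simp⟩
  | insert i s hi ih =>
    simp only [Finset.sum_insert hi]
    exact (hf i (by simp)).add (ih fun j hj ↦ hf j (by simp [hj]))

theorem mul_self (hg : IsBihomogeneous k g) : IsBihomogeneous (k + 1) (fun c ↦ c * g c) := by
  obtain ⟨b, hb⟩ := hg
  refine ⟨fun p ↦ if p = 0 then 0 else b (p - 1), fun c ↦ ?_⟩
  simp only [hb]
  rw [Finset.sum_range_succ' _ (k + 1), Finset.mul_sum]
  simp only [Nat.add_eq_zero_iff, one_ne_zero, and_false, ↓reduceIte, Nat.add_sub_cancel, zero_mul,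
    add_zero, Nat.add_sub_add_right]
  exact Finset.sum_congr rfl fun p _ ↦ by ring

theorem mul_conj (hg : IsBihomogeneous k g) :
    IsBihomogeneous (k + 1) (fun c ↦ conj c * g c) := by
  obtain ⟨b, hb⟩ := hg
  refine ⟨fun p ↦ if p = k + 1 then 0 else b p, fun c ↦ ?_⟩
  simp only [hb]
  rw [Finset.sum_range_succ _ (k + 1), Finset.mul_sum]
  simp only [↓reduceIte, zero_mul, add_zero]
  refine Finset.sum_congr rfl fun p hp ↦ ?_
  have hp' : p ≤ k := Nat.lt_succ_iff.1 (Finset.mem_range.1 hp)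
  rw [if_neg (by omega), show k + 1 - p = k - p + 1 by omega]
  ring

theorem mul_re (hg : IsBihomogeneous k g) :
    IsBihomogeneous (k + 1) (fun c ↦ (c.re : ℂ) * g c) := by
  convert (hg.mul_self.const_mul (1 / 2)).add (hg.mul_conj.const_mul (1 / 2)) using 2 with c
  rw [Complex.re_eq_add_conj]
  ring

theorem mul_im (hg : IsBihomogeneous k g) :
    IsBihomogeneous (k + 1) (fun c ↦ (c.im : ℂ) * g c) := by
  convert (hg.mul_self.const_mul (1 / (2 * Complex.I))).add
    (hg.mul_conj.const_mul (-1 / (2 * Complex.I))) using 2 with c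
  rw [Complex.im_eq_sub_conj]
  ring

theorem re_pow_mul_im_pow (a b : ℕ) :
    IsBihomogeneous (a + b) (fun c ↦ (c.re : ℂ) ^ a * (c.im : ℂ) ^ b) := by
  induction a with
  | zero =>
    induction b with
    | zero => exact ⟨fun _ ↦ 1, fun c ↦ by simp⟩
    | succ b ih =>
      rw [← Nat.add_assoc]
      convert ih.mul_im using 2 with c
      ring
  | succ a ih =>
    rw [Nat.succ_add]
    convert ih.mul_re using 2 with c
    ring

end IsBihomogeneous

/-- Evaluation at the points `1 + j * I`, `j = 0, …, k`, determines the coefficients of a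
polynomial that is homogeneous of degree `k` in `c` and `conj c`. -/
theorem exists_coefficient_weights (k : ℕ) : ∃ w : ℕ → ℕ → ℂ, ∀ p ≤ k, ∀ b : ℕ → ℂ,
    ∑ j ∈ Finset.range (k + 1), w p j * (∑ r ∈ Finset.range (k + 1),
      b r * ((1 + j * Complex.I) ^ r * conj (1 + j * Complex.I) ^ (k - r))) = b p := by
  have hconj (j : ℕ) : conj (1 + j * Complex.I) = 1 - j * Complex.I := by simp [sub_eq_add_neg]
  have hne (j : ℕ) : (1 - j * Complex.I : ℂ) ≠ 0 := fun h ↦ by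
    simpa using congrArg Complex.re h
  -- Divided by `conj c ^ k`, the sum becomes a polynomial of degree at most `k` in `c / conj c`.
  -- The points `c = 1 + j * I` give distinct quotients `t j`, so the Vandermonde matrix inverts
  -- evaluation.
  let t : Fin (k + 1) → ℂ := fun j ↦ (1 + (j : ℕ) * Complex.I) / (1 - (j : ℕ) * Complex.I)
  have ht : Function.Injective t := fun i j hij ↦ by
    have h := (div_eq_div_iff (hne i) (hne j)).1 hij
    have h' := congrArg Complex.im h
    simp at h'
    have : ((i : ℕ) : ℝ) = (j : ℕ) := by linarith
    exact Fin.ext (by exact_mod_cast this)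
  have hdet : IsUnit (Matrix.vandermonde t).det :=
    (Matrix.det_vandermonde_ne_zero_iff.2 ht).isUnit
  let A : Matrix (Fin (k + 1)) (Fin (k + 1)) ℂ := (Matrix.vandermonde t)⁻¹
  let B : Fin (k + 1) → Fin (k + 1) → ℂ := fun p j ↦ A p j
  have hB (p r : Fin (k + 1)) : ∑ j, B p j * t j ^ (r : ℕ) = if p = r then 1 else 0 := by
    have h := congrFun (congrFun (Matrix.nonsing_inv_mul _ hdet) p) r
    simpa [A, B, Matrix.mul_apply, Matrix.one_apply, Matrix.vandermonde_apply] using h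
  refine ⟨fun p j ↦ if h : p < k + 1 ∧ j < k + 1 then
    B ⟨p, h.1⟩ ⟨j, h.2⟩ / (1 - j * Complex.I) ^ k else 0, fun p hp b ↦ ?_⟩
  have hp' : p < k + 1 := Nat.lt_succ_of_le hp
  rw [Finset.sum_range]
  calc _ = ∑ j : Fin (k + 1), ∑ r : Fin (k + 1), b r * (B ⟨p, hp'⟩ j * t j ^ (r : ℕ)) := by
        refine Finset.sum_congr rfl fun j _ ↦ ?_
        simp only [dif_pos (And.intro hp' j.2)]
        rw [Finset.sum_range, Finset.mul_sum]
        refine Finset.sum_congr rfl fun r _ ↦ ?_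
        have hk : k = (k - r) + (r : ℕ) := by omega
        have h₁ : (1 - (j : ℕ) * Complex.I : ℂ) ^ k =
          (1 - (j : ℕ) * Complex.I) ^ (k - r) * (1 - (j : ℕ) * Complex.I) ^ (r : ℕ) := by
          rw [← pow_add, ← hk]
        have := hne j
        rw [hconj, h₁, div_pow]
        field_simp
    _ = ∑ r : Fin (k + 1), b r * ∑ j, B ⟨p, hp'⟩ j * t j ^ (r : ℕ) := by
        rw [Finset.sum_comm]
        simp [Finset.mul_sum]
    _ = b p := by simp [hB]

/-- The weights that extract the coefficient of `c ^ p * conj c ^ (k - p)`. -/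
def coefficientWeight (k : ℕ) : ℕ → ℕ → ℂ := (exists_coefficient_weights k).choose

theorem sum_coefficientWeight_mul {k p : ℕ} (hp : p ≤ k) {b : ℕ → ℂ} {g : ℂ → ℂ}
    (hg : ∀ c, g c = ∑ r ∈ Finset.range (k + 1), b r * (c ^ r * conj c ^ (k - r))) :
    ∑ j ∈ Finset.range (k + 1), coefficientWeight k p j * g (1 + j * Complex.I) = b p := by
  simp only [hg]
  exact (exists_coefficient_weights k).choose_spec p hp b

/-! ### The type decomposition of an alternating form -/

namespace ContinuousAlternatingMap

variable {V E : Type*} [AddCommGroup V] [Module ℝ V] [TopologicalSpace V] [AddCommGroup E] {k : ℕ}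

/-- A form that vanishes as soon as one argument lies in the kernel of `N` depends only on the
images of its arguments under `N`. -/
theorem eq_of_horizontal {G : Type*} [AddCommGroup G] [Module ℝ G] [TopologicalSpace G]
    {β : V [⋀^Fin k]→L[ℝ] G} {N : V → E} (hN : ∀ u v, N (u - v) = N u - N v)
    (hβ : ∀ (v : Fin k → V) (j : Fin k), N (v j) = 0 → β v = 0) {v w : Fin k → V}
    (h : ∀ l, N (v l) = N (w l)) : β v = β w := by
  have h₁ : v = w + (v - w) := by simp
  have h₂ := β.toMultilinearMap.map_add_univ w (v - w)
  rw [← h₁] at h₂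
  -- Any term with an argument `v j - w j`, which lies in the kernel of `N`, vanishes; only the term
  -- with all arguments from `w` survives.
  refine h₂.trans ((Finset.sum_eq_single_of_mem Finset.univ (Finset.mem_univ _) ?_).trans ?_)
  · intro S _ hS
    obtain ⟨j, hj⟩ : ∃ j, j ∉ S := by
      by_contra! hall
      exact hS (Finset.eq_univ_of_forall hall)
    refine hβ _ j ?_
    simp [Finset.piecewise_eq_of_notMem _ _ _ hj, hN, h]
  · simp

/-- Multilinear expansion gives monomials of degree `k` in `c.re` and `c.im`, which are linear
combinations of `c` and `conj c`. -/
theorem isBihomogeneous_apply (β : V [⋀^Fin k]→L[ℝ] ℂ) (v w : Fin k → V) :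
    IsBihomogeneous k (fun c ↦ β (fun l ↦ c.re • v l + c.im • w l)) := by
  have h (c : ℂ) : β (fun l ↦ c.re • v l + c.im • w l) = ∑ S : Finset (Fin k),
      β (S.piecewise v w) * ((c.re : ℂ) ^ S.card * (c.im : ℂ) ^ (k - S.card)) := by
    refine (β.toMultilinearMap.map_add_univ (fun l ↦ c.re • v l) (fun l ↦ c.im • w l)).trans ?_
    refine Finset.sum_congr rfl fun S _ ↦ ?_
    have h₁ : S.piecewise (fun l ↦ c.re • v l) (fun l ↦ c.im • w l) =
        fun l ↦ S.piecewise (fun _ ↦ c.re) (fun _ ↦ c.im) l • S.piecewise v w l := by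
      funext l
      by_cases hl : l ∈ S <;> simp [hl]
    rw [h₁, MultilinearMap.map_smul_univ, Finset.prod_piecewise]
    have h₂ : (Finset.univ \ S).card = k - S.card := by
      rw [Finset.card_sdiff_of_subset (Finset.subset_univ S)]; simp
    simp only [Finset.univ_inter, Finset.prod_const, h₂, Complex.real_smul]
    push_cast
    rw [mul_comm]
    rfl
  simp only [h]
  refine IsBihomogeneous.sum _ fun S _ ↦ IsBihomogeneous.const_mul _ ?_
  have hS : S.card + (k - S.card) = k := by
    have := S.card_le_univ
    simp at this
    omega
  simpa only [hS] using IsBihomogeneous.re_pow_mul_im_pow S.card (k - S.card)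

/-- No relation `J ^ 2 = -1` is assumed on `V`: the expression `c.re • v + c.im • J v` stands for
multiplication by `c` only after `N` is applied. -/
theorem map_lift [Module ℂ E] {N : V →ₗ[ℝ] E} {J : V →L[ℝ] V}
    (hJ : ∀ v, N (J v) = Complex.I • N v) (c : ℂ) (v : V) :
    N (c.re • v + c.im • J v) = c • N v := by
  have h (a : ℝ) (u : V) : N (a • u) = (a : ℂ) • N u := by
    rw [map_smul]; rfl
  rw [map_add, h, h, hJ, smul_smul, ← add_smul, Complex.re_add_im]

variable [IsTopologicalAddGroup V] [ContinuousConstSMul ℝ V]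

/-- The component of type `(p, k - p)` of a form, with respect to an operator `J` that lifts the
multiplication by `I`. -/
def typeComponent (J : V →L[ℝ] V) (β : V [⋀^Fin k]→L[ℝ] ℂ) (p : ℕ) : V [⋀^Fin k]→L[ℝ] ℂ :=
  ∑ j ∈ Finset.range (k + 1), coefficientWeight k p j •
    β.compContinuousLinearMap (ContinuousLinearMap.id ℝ V + (j : ℝ) • J)

theorem typeComponent_apply (J : V →L[ℝ] V) (β : V [⋀^Fin k]→L[ℝ] ℂ) (p : ℕ) (v : Fin k → V) :
    typeComponent J β p v = ∑ j ∈ Finset.range (k + 1), coefficientWeight k p j *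
      β (fun l ↦ v l + (j : ℝ) • J (v l)) := by
  rw [typeComponent, ContinuousAlternatingMap.sum_apply]
  rfl

theorem typeComponent_eq {J : V →L[ℝ] V} {β : V [⋀^Fin k]→L[ℝ] ℂ} {v : Fin k → V} {b : ℕ → ℂ}
    (h : ∀ c : ℂ, β (fun l ↦ c.re • v l + c.im • J (v l)) =
      ∑ r ∈ Finset.range (k + 1), b r * (c ^ r * conj c ^ (k - r))) {p : ℕ} (hp : p ≤ k) :
    typeComponent J β p v = b p := by
  rw [typeComponent_apply, ← sum_coefficientWeight_mul hp h]
  simp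

theorem apply_eq_sum_typeComponent (J : V →L[ℝ] V) (β : V [⋀^Fin k]→L[ℝ] ℂ) (v : Fin k → V)
    (c : ℂ) : β (fun l ↦ c.re • v l + c.im • J (v l)) =
      ∑ r ∈ Finset.range (k + 1), typeComponent J β r v * (c ^ r * conj c ^ (k - r)) := by
  obtain ⟨b, hb⟩ := isBihomogeneous_apply β v (fun l ↦ J (v l))
  refine (hb c).trans (Finset.sum_congr rfl fun r hr ↦ ?_)
  rw [typeComponent_eq hb (Nat.lt_succ_iff.1 (Finset.mem_range.1 hr))]

theorem sum_typeComponent (J : V →L[ℝ] V) (β : V [⋀^Fin k]→L[ℝ] ℂ) :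
    ∑ r ∈ Finset.range (k + 1), typeComponent J β r = β := by
  ext v
  have h := apply_eq_sum_typeComponent J β v 1
  simp only [Complex.one_re, one_smul, Complex.one_im, zero_smul, add_zero, one_pow, map_one,
    mul_one] at h
  rw [ContinuousAlternatingMap.sum_apply, ← h]

variable [Module ℂ E] {N : V →ₗ[ℝ] E} {J : V →L[ℝ] V} {β : V [⋀^Fin k]→L[ℝ] ℂ}

theorem typeComponent_horizontal (hJ : ∀ v, N (J v) = Complex.I • N v)
    (hβ : ∀ (v : Fin k → V) (j : Fin k), N (v j) = 0 → β v = 0) (p : ℕ) (v : Fin k → V)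
    (j : Fin k) (hv : N (v j) = 0) : typeComponent J β p v = 0 := by
  rw [typeComponent_apply]
  refine Finset.sum_eq_zero fun i _ ↦ ?_
  rw [hβ _ j (by simp [hJ, hv]), mul_zero]

/-- By horizontality, `e` acting on `w` may be replaced by `e * c` acting on `v`. Comparing
coefficients of the two polynomials in `e` gives the factor `c ^ p * conj c ^ q`. -/
theorem typeComponent_type (hJ : ∀ v, N (J v) = Complex.I • N v)
    (hβ : ∀ (v : Fin k → V) (j : Fin k), N (v j) = 0 → β v = 0) {p q : ℕ} (hpq : p + q = k)
    {c : ℂ} {v w : Fin k → V} (h : ∀ l, N (w l) = c • N (v l)) :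
    typeComponent J β p w = c ^ p * conj c ^ q * typeComponent J β p v := by
  have h₁ (e : ℂ) : β (fun l ↦ e.re • w l + e.im • J (w l)) =
      ∑ r ∈ Finset.range (k + 1), (c ^ r * conj c ^ (k - r) * typeComponent J β r v) *
        (e ^ r * conj e ^ (k - r)) := by
    have h₂ : β (fun l ↦ e.re • w l + e.im • J (w l)) =
        β (fun l ↦ (e * c).re • v l + (e * c).im • J (v l)) := by
      refine eq_of_horizontal (N := N) (map_sub N) hβ fun l ↦ ?_
      rw [map_lift hJ, map_lift hJ, h, smul_smul]
    rw [h₂, apply_eq_sum_typeComponent]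
    refine Finset.sum_congr rfl fun r _ ↦ ?_
    rw [map_mul, mul_pow, mul_pow]
    ring
  rw [typeComponent_eq h₁ (by omega : p ≤ k), show k - p = q by omega]

end ContinuousAlternatingMap

/-! ### Adapted parametrizations -/

section RealStructure

variable {E E' N N' : Type*} [NormedAddCommGroup E] [NormedSpace ℂ E]
  [NormedAddCommGroup E'] [NormedSpace ℂ E']
  [TopologicalSpace N] [ChartedSpace E N] [TopologicalSpace N'] [ChartedSpace E' N']

/-- A complex manifold is a smooth real manifold. -/
theorem isManifold_real_of_complex [IsManifold 𝓘(ℂ, E) ω N] : IsManifold 𝓘(ℝ, E) ∞ N := by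
  refine isManifold_of_contDiffOn _ _ _ fun e e' he he' ↦ ?_
  have h := (contDiffGroupoid ω 𝓘(ℂ, E)).compatible he he'
  rw [contDiffGroupoid, mem_groupoid_of_pregroupoid] at h
  exact (h.1.restrict_scalars ℝ).of_le le_top

theorem MDifferentiableAt.hasMFDerivAt_real {g : N → N'} {y : N}
    (h : MDifferentiableAt 𝓘(ℂ, E) 𝓘(ℂ, E') g y) :
    HasMFDerivAt 𝓘(ℝ, E) 𝓘(ℝ, E') g y
      ((mfderiv 𝓘(ℂ, E) 𝓘(ℂ, E') g y : E →L[ℂ] E').restrictScalars ℝ : E →L[ℝ] E') :=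
  ⟨h.hasMFDerivAt.1, HasFDerivWithinAt.restrictScalars ℝ h.hasMFDerivAt.2⟩

end RealStructure

namespace TransverselyHolomorphicFoliation

variable {m n : ℕ} {M T₀ ι : Type*}
  [TopologicalSpace M] [ChartedSpace (EuclideanSpace ℝ (Fin m)) M]
  [TopologicalSpace T₀] [ChartedSpace (EuclideanSpace ℂ (Fin n)) T₀]

theorem exists_mem (F : TransverselyHolomorphicFoliation m n M T₀ ι) (x : M) :
    ∃ i, x ∈ F.U i := by
  have h : x ∈ ⋃ i, F.U i := F.cover ▸ Set.mem_univ x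
  simpa using h

/-- Differentiating the cocycle relation gives `A`, and holomorphy of `γ i j` makes it complex
linear. Hence tangency to the leaves and the transverse complex structure can be tested with any one
index. -/
theorem exists_df_eq (F : TransverselyHolomorphicFoliation m n M T₀ ι) {i j : ι} {x : M}
    (hi : x ∈ F.U i) (hj : x ∈ F.U j) :
    ∃ A : EuclideanSpace ℂ (Fin n) →ₗ[ℂ] EuclideanSpace ℂ (Fin n),
      ∀ v, F.df j x v = A (F.df i x v) := by
  have h₁ : F.f j =ᶠ[nhds x] F.γ i j ∘ F.f i := by
    filter_upwards [(F.isOpen_U i).mem_nhds hi, (F.isOpen_U j).mem_nhds hj] with y hy hy'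
    exact F.cocycle i j y ⟨hy, hy'⟩
  have h₂ := F.holomorphic i j (F.f i x) ⟨x, ⟨hi, hj⟩, rfl⟩
  have h₃ := ((F.submersion i x hi).contMDiffAt.mdifferentiableAt (by simp)).hasMFDerivAt
  let A : EuclideanSpace ℂ (Fin n) →L[ℂ] EuclideanSpace ℂ (Fin n) :=
    mfderiv 𝓘(ℂ, EuclideanSpace ℂ (Fin n)) 𝓘(ℂ, EuclideanSpace ℂ (Fin n)) (F.γ i j) (F.f i x)
  refine ⟨A, fun v ↦ ?_⟩
  rw [df, h₁.mfderiv_eq, (HasMFDerivAt.comp x h₂.hasMFDerivAt_real h₃).mfderiv]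
  rfl

theorem isTangent_iff (F : TransverselyHolomorphicFoliation m n M T₀ ι) {i : ι} {x : M}
    (hi : x ∈ F.U i) (v : TangentSpace (𝓡 m) x) : F.IsTangent x v ↔ F.df i x v = 0 := by
  refine ⟨fun h ↦ h i hi, fun h j hj ↦ ?_⟩
  obtain ⟨A, hA⟩ := F.exists_df_eq hi hj
  rw [hA, h, map_zero]

/-- A smooth parametrization `σ` of `M` around `x` by a product `ℂⁿ × C`, with local inverse `τ`,
under which the submersion `f i` becomes the first projection, up to a holomorphic change of
coordinates. -/
structure IsAdaptedParametrization (F : TransverselyHolomorphicFoliation m n M T₀ ι) (i : ι) (x : M)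
    {C : Type*} [NormedAddCommGroup C] [NormedSpace ℝ C]
    (σ : EuclideanSpace ℂ (Fin n) × C → M) (τ : M → EuclideanSpace ℂ (Fin n) × C) : Prop where
  contMDiffAt_inv : ContMDiffAt (𝓡 m) 𝓘(ℝ, EuclideanSpace ℂ (Fin n) × C) ∞ τ x
  contMDiffAt : ∀ᶠ z in nhds (τ x),
    ContMDiffAt 𝓘(ℝ, EuclideanSpace ℂ (Fin n) × C) (𝓡 m) ∞ σ z
  right_inv : ∀ᶠ y in nhds x, σ (τ y) = y
  mem : ∀ᶠ z in nhds (τ x), σ z ∈ F.U i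
  df_mfderiv : ∀ᶠ z in nhds (τ x),
    ∃ B : EuclideanSpace ℂ (Fin n) ≃ₗ[ℂ] EuclideanSpace ℂ (Fin n),
      ∀ v : EuclideanSpace ℂ (Fin n) × C,
        F.df i (σ z) (mfderiv 𝓘(ℝ, EuclideanSpace ℂ (Fin n) × C) (𝓡 m) σ z v) = B v.1

variable [IsManifold 𝓘(ℂ, EuclideanSpace ℂ (Fin n)) ω T₀]

/-- The normal form of a submersion provides the product structure. Its chart on `T₀` is only
smooth, so the first coordinate is replaced by a holomorphic one, and `f` becomes the inverse of a
holomorphic chart after the first projection. -/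
theorem exists_isAdaptedParametrization (F : TransverselyHolomorphicFoliation m n M T₀ ι) {i : ι}
    {x : M} (hx : x ∈ F.U i) :
    ∃ (C : Type) (_ : NormedAddCommGroup C) (_ : NormedSpace ℝ C)
      (σ : EuclideanSpace ℂ (Fin n) × C → M) (τ : M → EuclideanSpace ℂ (Fin n) × C),
      F.IsAdaptedParametrization i x σ τ := by
  have : IsManifold 𝓘(ℝ, EuclideanSpace ℂ (Fin n)) ∞ T₀ := isManifold_real_of_complex
  have hs := F.submersion i x hx
  set f := F.f i with hf
  obtain ⟨C, _, _, ⟨φ, ψ, hxφ, hxψ, hφ, hψ, hφψ, L, hL⟩⟩ := hs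
  set χ := chartAt (EuclideanSpace ℂ (Fin n)) (f x) with hχ
  have hfφ : ∀ y ∈ φ.source, ψ (f y) = (L (φ y)).1 := fun y hy ↦ by
    have := hL (x := φ y) (by simpa using φ.map_source hy)
    simpa [φ.left_inv hy] using this
  have hfx : ContMDiffAt (𝓡 m) 𝓘(ℝ, EuclideanSpace ℂ (Fin n)) ∞ f x :=
    (F.submersion i x hx).contMDiffAt
  have hχx : f x ∈ χ.source := mem_chart_source _ _
  -- The factor `ψ ∘ χ.symm` passes from the holomorphic chart `χ` to the smooth chart `ψ` of the
  -- normal form.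
  let e : EuclideanSpace ℂ (Fin n) × C → EuclideanSpace ℝ (Fin m) :=
    fun z ↦ L.symm (ψ (χ.symm z.1), z.2)
  let σ : EuclideanSpace ℂ (Fin n) × C → M := fun z ↦ φ.symm (e z)
  let τ : M → EuclideanSpace ℂ (Fin n) × C := fun y ↦ (χ (f y), (L (φ y)).2)
  have hτx : τ x = (χ (f x), (L (φ x)).2) := rfl
  have hστ : ∀ y ∈ φ.source, f y ∈ χ.source → σ (τ y) = y := fun y hy hy' ↦ by
    simp only [σ, e, τ, χ.left_inv hy', hfφ y hy, Prod.mk.eta, L.symm_apply_apply, φ.left_inv hy]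
  have heτx : e (τ x) = φ x := by
    simp only [e, τ, χ.left_inv hχx, hfφ x hxφ, Prod.mk.eta, L.symm_apply_apply]
  have hφs := contMDiffOn_symm_of_mem_maximalAtlas hφ
  have hφc := contMDiffOn_of_mem_maximalAtlas hφ
  have hψc := contMDiffOn_of_mem_maximalAtlas hψ
  have hχs : ContMDiffOn 𝓘(ℝ, EuclideanSpace ℂ (Fin n)) 𝓘(ℝ, EuclideanSpace ℂ (Fin n)) ∞
    χ.symm χ.target := contMDiffOn_chart_symm
  have hχc : ContMDiffOn 𝓘(ℝ, EuclideanSpace ℂ (Fin n)) 𝓘(ℝ, EuclideanSpace ℂ (Fin n)) ∞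
    χ χ.source := contMDiffOn_chart
  have hfst (z : EuclideanSpace ℂ (Fin n) × C) : ContMDiffAt 𝓘(ℝ, EuclideanSpace ℂ (Fin n) × C)
      𝓘(ℝ, EuclideanSpace ℂ (Fin n)) ∞ Prod.fst z := contDiffAt_fst.contMDiffAt
  have hsnd (z : EuclideanSpace ℂ (Fin n) × C) : ContMDiffAt 𝓘(ℝ, EuclideanSpace ℂ (Fin n) × C)
      𝓘(ℝ, C) ∞ Prod.snd z := contDiffAt_snd.contMDiffAt
  have he : ∀ z : EuclideanSpace ℂ (Fin n) × C, z.1 ∈ χ.target → χ.symm z.1 ∈ ψ.source →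
      ContMDiffAt 𝓘(ℝ, EuclideanSpace ℂ (Fin n) × C) (𝓡 m) ∞ e z := fun z h₁ h₂ ↦ by
    have h₃ : ContMDiffAt 𝓘(ℝ, EuclideanSpace ℂ (Fin n) × C) 𝓘(ℝ, EuclideanSpace ℂ (Fin n)) ∞
        (fun z ↦ ψ (χ.symm z.1)) z :=
      (hψc.contMDiffAt (ψ.open_source.mem_nhds h₂)).comp z
        ((hχs.contMDiffAt (χ.open_target.mem_nhds h₁)).comp z (hfst z))
    exact (L.symm.contDiff.contDiffAt.comp z
      (h₃.contDiffAt.prodMk (hsnd z).contDiffAt)).contMDiffAt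
  have hG : ∀ᶠ z in nhds (τ x), z.1 ∈ χ.target ∧ χ.symm z.1 ∈ ψ.source ∧ e z ∈ φ.target := by
    have h₁ : (τ x).1 ∈ χ.target := χ.map_source hχx
    have h₂ : χ.symm (τ x).1 ∈ ψ.source := by
      simpa only [τ, χ.left_inv hχx] using hxψ
    refine (continuous_fst.continuousAt.eventually (χ.open_target.mem_nhds h₁)).and
      (Filter.Eventually.and ?_ ?_)
    · exact (ContinuousAt.comp (g := χ.symm) (χ.continuousAt_symm h₁)
        continuous_fst.continuousAt).eventually (ψ.open_source.mem_nhds h₂)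
    · exact (he _ h₁ h₂).continuousAt.eventually
        (φ.open_target.mem_nhds (heτx ▸ φ.map_source hxφ))
  have hσ : ∀ z, z.1 ∈ χ.target ∧ χ.symm z.1 ∈ ψ.source ∧ e z ∈ φ.target →
      ContMDiffAt 𝓘(ℝ, EuclideanSpace ℂ (Fin n) × C) (𝓡 m) ∞ σ z := fun z hz ↦
    (hφs.contMDiffAt (φ.open_target.mem_nhds hz.2.2)).comp z (he z hz.1 hz.2.1)
  have hfσ : ∀ z, z.1 ∈ χ.target ∧ χ.symm z.1 ∈ ψ.source ∧ e z ∈ φ.target →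
      f (σ z) = χ.symm z.1 := fun z hz ↦ by
    have h₁ : σ z ∈ φ.source := φ.map_target hz.2.2
    refine ψ.injOn (hφψ h₁) hz.2.1 ?_
    rw [hfφ _ h₁]
    simp only [σ, φ.right_inv hz.2.2]
    simp [e]
  have hU : ∀ᶠ z in nhds (τ x), σ z ∈ F.U i := by
    refine (hσ _ hG.self_of_nhds).continuousAt.eventually ((F.isOpen_U i).mem_nhds ?_)
    rwa [hστ x hxφ hχx]
  refine ⟨C, inferInstance, inferInstance, σ, τ, ?_, hG.mono hσ, ?_, hU, ?_⟩
  · have h₁ : ContMDiffAt (𝓡 m) 𝓘(ℝ, EuclideanSpace ℂ (Fin n)) ∞ (fun y ↦ χ (f y)) x :=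
      (hχc.contMDiffAt (χ.open_source.mem_nhds hχx)).comp x hfx
    have h₂ : ContMDiffAt (𝓡 m) 𝓘(ℝ, C) ∞ (fun y ↦ (L (φ y)).2) x :=
      (((contDiff_snd.comp L.contDiff).contMDiff).contMDiffAt).comp x
        (hφc.contMDiffAt (φ.open_source.mem_nhds hxφ))
    exact h₁.prodMk_space h₂
  · filter_upwards [φ.open_source.mem_nhds hxφ,
      hfx.continuousAt.eventually (χ.open_source.mem_nhds hχx)] with y hy hy'
    exact hστ y hy hy'
  · filter_upwards [hG.eventually_nhds, hU] with z hz hzU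
    have hz' := hz.self_of_nhds
    have hχd : MDifferentiableAt 𝓘(ℂ, EuclideanSpace ℂ (Fin n)) 𝓘(ℂ, EuclideanSpace ℂ (Fin n))
        χ.symm z.1 := mdifferentiableAt_atlas_symm (chart_mem_atlas _ _) hz'.1
    have hχe : χ.MDifferentiable 𝓘(ℂ, EuclideanSpace ℂ (Fin n)) 𝓘(ℂ, EuclideanSpace ℂ (Fin n)) :=
      mdifferentiable_chart _
    let B : EuclideanSpace ℂ (Fin n) ≃L[ℂ] EuclideanSpace ℂ (Fin n) := hχe.symm.mfderiv hz'.1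
    refine ⟨B.toLinearEquiv, fun v ↦ ?_⟩
    have h₁ : mfderiv 𝓘(ℝ, EuclideanSpace ℂ (Fin n) × C) 𝓘(ℝ, EuclideanSpace ℂ (Fin n))
        (f ∘ σ) z = (mfderiv (𝓡 m) 𝓘(ℝ, EuclideanSpace ℂ (Fin n)) f (σ z)).comp
          (mfderiv 𝓘(ℝ, EuclideanSpace ℂ (Fin n) × C) (𝓡 m) σ z) :=
      mfderiv_comp z ((F.submersion i _ hzU).contMDiffAt.mdifferentiableAt (by simp))
        ((hσ z hz').mdifferentiableAt (by simp))
    have h₂ : f ∘ σ =ᶠ[nhds z] χ.symm ∘ Prod.fst := hz.mono hfσ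
    have h₃ := (HasMFDerivAt.comp z hχd.hasMFDerivAt_real
      ((hasFDerivAt_fst (𝕜 := ℝ) (p := z)).hasMFDerivAt)).mfderiv
    have h₄ : mfderiv 𝓘(ℝ, EuclideanSpace ℂ (Fin n) × C) 𝓘(ℝ, EuclideanSpace ℂ (Fin n))
        (f ∘ σ) z v = B v.1 := by
      rw [h₂.mfderiv_eq, h₃]
      rfl
    rw [h₁] at h₄
    exact h₄

theorem df_surjective (F : TransverselyHolomorphicFoliation m n M T₀ ι) {i : ι} {x : M}
    (hi : x ∈ F.U i) : Function.Surjective (F.df i x) := by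
  obtain ⟨C, _, _, σ, τ, h⟩ := F.exists_isAdaptedParametrization hi
  obtain ⟨B, hB⟩ := h.df_mfderiv.self_of_nhds
  rw [h.right_inv.self_of_nhds] at hB
  intro u
  exact ⟨_, (hB (B.symm u, 0)).trans (B.apply_symm_apply u)⟩

/-- A linear section of `df i` lifts multiplication by `I`, and complex linearity of the transition
differentials makes the lift valid for all indices. The choice is made point by point, without any
continuity in `x`. -/
theorem exists_transverseJ (F : TransverselyHolomorphicFoliation m n M T₀ ι) (x : M) :
    ∃ J : TangentSpace (𝓡 m) x →L[ℝ] TangentSpace (𝓡 m) x,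
      ∀ i, x ∈ F.U i → ∀ v, F.df i x (J v) = Complex.I • F.df i x v := by
  obtain ⟨i, hi⟩ := F.exists_mem x
  let N : EuclideanSpace ℝ (Fin m) →ₗ[ℝ] EuclideanSpace ℂ (Fin n) := (F.df i x).toLinearMap
  obtain ⟨s, hs⟩ := N.exists_rightInverse_of_surjective
    (LinearMap.range_eq_top.2 (F.df_surjective hi))
  let J : EuclideanSpace ℝ (Fin m) →ₗ[ℝ] EuclideanSpace ℝ (Fin m) :=
    s ∘ₗ ((Complex.I • LinearMap.id : EuclideanSpace ℂ (Fin n) →ₗ[ℂ] _).restrictScalars ℝ) ∘ₗ N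
  refine ⟨J.toContinuousLinearMap, fun j hj v ↦ ?_⟩
  have h : F.df i x (J v) = Complex.I • F.df i x v :=
    LinearMap.congr_fun hs (Complex.I • F.df i x v)
  obtain ⟨A, hA⟩ := F.exists_df_eq hi hj
  rw [hA, hA]
  exact (congrArg A h).trans (map_smul A _ _)

end TransverselyHolomorphicFoliation

/-! ### Horizontal forms and types on a product -/

section Flat

variable {E W G : Type*} [NormedAddCommGroup W] [NormedSpace ℝ W] [NormedAddCommGroup G]
  [NormedSpace ℝ G] {k : ℕ}

theorem fderiv_alternating_apply_eq {A B : W → W [⋀^Fin k]→L[ℝ] G} {z : W}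
    (hA : DifferentiableAt ℝ A z) (hB : DifferentiableAt ℝ B z) {v w : Fin k → W}
    (h : ∀ᶠ y in nhds z, A y v = B y w) (u : W) : fderiv ℝ A z u v = fderiv ℝ B z u w := by
  rw [← fderiv_continuousAlternatingMap_apply_const_apply hA,
    ← fderiv_continuousAlternatingMap_apply_const_apply hB]
  exact congrArg (fun L : W →L[ℝ] G ↦ L u) (Filter.EventuallyEq.fderiv_eq h)

/-- Every summand except the `j`-th keeps the vertical vector `v j` as an argument of `A`, which
vanishes there near `z`, so its derivative is zero. -/
theorem extDeriv_apply_of_horizontal [AddCommGroup E] {N : W → E}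
    {A : W → W [⋀^Fin k]→L[ℝ] G} {z : W}
    (hA : DifferentiableAt ℝ A z)
    (h : ∀ᶠ y in nhds z, ∀ (v : Fin k → W) (j : Fin k), N (v j) = 0 → A y v = 0)
    {v : Fin (k + 1) → W} {j : Fin (k + 1)} (hj : N (v j) = 0) :
    extDeriv A z v = (-1) ^ (j : ℕ) • fderiv ℝ A z (v j) (j.removeNth v) := by
  rw [extDeriv, ContinuousAlternatingMap.alternatizeUncurryFin_apply]
  refine Finset.sum_eq_single_of_mem j (Finset.mem_univ _) fun l _ hl ↦ ?_
  obtain ⟨r, hr⟩ := Fin.exists_succAbove_eq hl.symm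
  have h₁ : ∀ᶠ y in nhds z, A y (l.removeNth v) = (0 : W → W [⋀^Fin k]→L[ℝ] G) y
      (l.removeNth v) := by
    filter_upwards [h] with y hy
    exact hy _ r (by simpa [Fin.removeNth, hr] using hj)
  rw [fderiv_alternating_apply_eq hA (differentiableAt_const 0) h₁]
  simp

/-- For forms that are horizontal near `z`, the exterior derivative is horizontal at `z` if and
only if the derivatives of the form in the vertical directions vanish. -/
theorem extDeriv_horizontal_iff [AddCommGroup E] {N : W → E} {A : W → W [⋀^Fin k]→L[ℝ] G} {z : W}
    (hA : DifferentiableAt ℝ A z)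
    (h : ∀ᶠ y in nhds z, ∀ (v : Fin k → W) (j : Fin k), N (v j) = 0 → A y v = 0) :
    (∀ (v : Fin (k + 1) → W) (j : Fin (k + 1)), N (v j) = 0 → extDeriv A z v = 0) ↔
      ∀ u, N u = 0 → fderiv ℝ A z u = 0 := by
  refine ⟨fun hd u hu ↦ ?_, fun hd v j hj ↦ ?_⟩
  · ext v
    have h₀ : N ((Fin.cons u v : Fin (k + 1) → W) 0) = 0 := by simpa using hu
    have h₁ := hd (Fin.cons u v) 0 h₀
    rw [extDeriv_apply_of_horizontal hA h h₀] at h₁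
    simpa using h₁
  · rw [extDeriv_apply_of_horizontal hA h hj, hd _ hj]
    simp

/-- The exterior derivative of a form of type `(p, q)` has components of type `(p + 1, q)` and
`(p, q + 1)` only. -/
theorem typeComponent_extDeriv_eq_zero {A : W → W [⋀^Fin k]→L[ℝ] ℂ} {z : W} {J : W →L[ℝ] W}
    {p q : ℕ} (hpq : p + q = k) (hA : DifferentiableAt ℝ A z)
    (h : ∀ᶠ y in nhds z, ∀ (c : ℂ) (v : Fin k → W),
      A y (fun l ↦ c.re • v l + c.im • J (v l)) = c ^ p * conj c ^ q * A y v)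
    {r : ℕ} (hr : r ≤ k + 1) (hrp : r ≠ p) (hrp' : r ≠ p + 1) :
    ContinuousAlternatingMap.typeComponent J (extDeriv A z) r = 0 := by
  ext v
  let D : (W → W) → ℂ := fun g ↦
    ∑ l : Fin (k + 1), (-1) ^ (l : ℕ) • fderiv ℝ A z (g (v l)) (l.removeNth v)
  -- `D id` and `D J` sum the derivatives in the directions `v l` and `J (v l)`. Rewriting `c.re * D
  -- id + c.im * D J` in terms of `c` and `conj c` gives these two coefficients, the `∂` and the
  -- `∂̄` part.
  let b : ℕ → ℂ := fun s ↦ if s = p + 1 then (D id - Complex.I * D J) / 2 else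
    if s = p then (D id + Complex.I * D J) / 2 else 0
  have hb : ContinuousAlternatingMap.typeComponent J (extDeriv A z) r v = b r := by
    refine ContinuousAlternatingMap.typeComponent_eq (fun c ↦ ?_) hr
    have h₁ (l : Fin (k + 1)) (u : W) :
        fderiv ℝ A z u (l.removeNth fun l ↦ c.re • v l + c.im • J (v l)) =
          c ^ p * conj c ^ q * fderiv ℝ A z u (l.removeNth v) := by
      have h₂ : ∀ᶠ y in nhds z, A y (l.removeNth fun l ↦ c.re • v l + c.im • J (v l)) =
          ((c ^ p * conj c ^ q) • A) y (l.removeNth v) := by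
        filter_upwards [h] with y hy
        exact hy c (l.removeNth v)
      rw [fderiv_alternating_apply_eq hA (hA.const_smul _) h₂, fderiv_const_smul hA]
      rfl
    rw [extDeriv, ContinuousAlternatingMap.alternatizeUncurryFin_apply]
    have h₃ : ∑ l : Fin (k + 1), (-1) ^ (l : ℕ) • fderiv ℝ A z (c.re • v l + c.im • J (v l))
        (l.removeNth fun l ↦ c.re • v l + c.im • J (v l)) =
        c ^ p * conj c ^ q * (c.re * D id + c.im * D J) := by
      simp only [D, h₁, Finset.mul_sum, ← Finset.sum_add_distrib]
      refine Finset.sum_congr rfl fun l _ ↦ ?_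
      simp only [map_add, map_smul, ContinuousAlternatingMap.add_apply,
        ContinuousAlternatingMap.smul_apply, Complex.real_smul, zsmul_eq_mul, id]
      push_cast
      ring
    rw [h₃]
    have hp₁ : p ∈ Finset.range (k + 1 + 1) := by simp; omega
    have hp₂ : p + 1 ∈ Finset.range (k + 1 + 1) := by simp; omega
    have h₄ (s : ℕ) : b s * (c ^ s * conj c ^ (k + 1 - s)) =
        (if s = p + 1 then (D id - Complex.I * D J) / 2 * (c ^ (p + 1) * conj c ^ q) else 0) +
        (if s = p then (D id + Complex.I * D J) / 2 * (c ^ p * conj c ^ (q + 1)) else 0) := by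
      by_cases hs : s = p + 1
      · subst hs
        simp [b, show k + 1 - (p + 1) = q by omega]
      · by_cases hs' : s = p
        · subst hs'
          simp [b, show k + 1 - s = q + 1 by omega]
        · simp [b, hs, hs']
    simp only [h₄, Finset.sum_add_distrib, Finset.sum_ite_eq', hp₁, hp₂, if_true]
    rw [Complex.re_eq_add_conj, Complex.im_eq_sub_conj]
    have hI : (2 * Complex.I)⁻¹ = -Complex.I / 2 := by
      rw [mul_inv, Complex.inv_I]; ring
    rw [div_eq_mul_inv (c - conj c), hI]
    ring
  rw [hb]
  simp [b, hrp, hrp']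

/-- `ContinuousAlternatingMap.typeComponent` as a continuous linear map. -/
def typeComponentCLM (J : W →L[ℝ] W) (k p : ℕ) : (W [⋀^Fin k]→L[ℝ] ℂ) →L[ℝ] W [⋀^Fin k]→L[ℝ] ℂ :=
  ∑ j ∈ Finset.range (k + 1), coefficientWeight k p j •
    ContinuousAlternatingMap.compContinuousLinearMapCLM
      (ContinuousLinearMap.id ℝ W + (j : ℝ) • J)

theorem typeComponentCLM_apply (J : W →L[ℝ] W) (k p : ℕ) (β : W [⋀^Fin k]→L[ℝ] ℂ) :
    typeComponentCLM J k p β = ContinuousAlternatingMap.typeComponent J β p := by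
  simp only [typeComponentCLM, ContinuousAlternatingMap.typeComponent,
    _root_.sum_apply]
  rfl

end Flat

/-! ### The type decomposition of basic forms -/

namespace TransverselyHolomorphicFoliation

variable {m n : ℕ} {M T₀ ι : Type*}
  [TopologicalSpace M] [ChartedSpace (EuclideanSpace ℝ (Fin m)) M]
  [TopologicalSpace T₀] [ChartedSpace (EuclideanSpace ℂ (Fin n)) T₀]
  {F : TransverselyHolomorphicFoliation m n M T₀ ι} {k : ℕ}

theorem IsHorizontal.apply_eq_zero {𝕜 : Type*} [RCLike 𝕜] {α : DiffForm m M 𝕜 k}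
    (h : F.IsHorizontal α) {i : ι} {x : M}
    (hi : x ∈ F.U i) (v : Fin k → TangentSpace (𝓡 m) x) (j : Fin k) (hv : F.df i x (v j) = 0) :
    α x v = 0 :=
  h x v j ((F.isTangent_iff hi _).2 hv)

/-- The multiplication by `I` on the first factor of `ℂⁿ × C`. -/
def fstJ (n : ℕ) (C : Type*) [NormedAddCommGroup C] [NormedSpace ℝ C] :
    EuclideanSpace ℂ (Fin n) × C →L[ℝ] EuclideanSpace ℂ (Fin n) × C :=
  ContinuousLinearMap.prod
    (((Complex.I • ContinuousLinearMap.id ℂ (EuclideanSpace ℂ (Fin n))).restrictScalars ℝ).comp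
      (ContinuousLinearMap.fst ℝ _ _)) 0

theorem fst_fstJ {C : Type*} [NormedAddCommGroup C] [NormedSpace ℝ C]
    (v : EuclideanSpace ℂ (Fin n) × C) : (fstJ n C v).1 = Complex.I • v.1 := rfl

namespace IsAdaptedParametrization

variable {C : Type*} [NormedAddCommGroup C] [NormedSpace ℝ C]
  {σ : EuclideanSpace ℂ (Fin n) × C → M} {τ : M → EuclideanSpace ℂ (Fin n) × C} {i : ι} {x : M}

theorem exists_mfderiv_eq (h : F.IsAdaptedParametrization i x σ τ) (v : EuclideanSpace ℝ (Fin m)) :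
    ∃ ξ : EuclideanSpace ℂ (Fin n) × C,
      mfderiv 𝓘(ℝ, EuclideanSpace ℂ (Fin n) × C) (𝓡 m) σ (τ x) ξ = v := by
  have h₁ : σ ∘ τ =ᶠ[nhds x] id := h.right_inv
  have h₂ := h₁.mfderiv_eq (I := 𝓡 m) (I' := 𝓡 m)
  rw [mfderiv_comp x (h.contMDiffAt.self_of_nhds.mdifferentiableAt (by simp))
    (h.contMDiffAt_inv.mdifferentiableAt (by simp)), mfderiv_id] at h₂
  exact ⟨_, congrArg (fun L : EuclideanSpace ℝ (Fin m) →L[ℝ] EuclideanSpace ℝ (Fin m) ↦ L v) h₂⟩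

/-- Reduces an evaluation at `x` to one on `ℂⁿ × C`; vectors tangent to the leaves become vertical
because `B` is injective. -/
theorem exists_pullback_eq (h : F.IsAdaptedParametrization i x σ τ)
    (v : Fin k → TangentSpace (𝓡 m) x) :
    ∃ ξ : Fin k → EuclideanSpace ℂ (Fin n) × C, (∀ l, F.df i x (v l) = 0 → (ξ l).1 = 0) ∧
      ∀ β : DiffForm m M ℂ k, β x v = β.pullback σ (τ x) ξ := by
  choose g hg using h.exists_mfderiv_eq
  obtain ⟨B, hB⟩ := h.df_mfderiv.self_of_nhds
  have hx : σ (τ x) = x := h.right_inv.self_of_nhds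
  refine ⟨fun l ↦ g (v l), fun l hl ↦ ?_, fun β ↦ ?_⟩
  · have h₁ (y : M) (hy : y = x) : F.df i y (v l) = F.df i x (v l) := by rw [hy]
    have h₂ : B (g (v l)).1 = 0 :=
      ((hB (g (v l))).symm.trans (congrArg (F.df i (σ (τ x))) (hg (v l)))).trans
        ((h₁ _ hx).trans hl)
    exact B.map_eq_zero_iff.1 h₂
  · have h₁ (y : M) (hy : y = x) : β y v = β x v := by rw [hy]
    exact (h₁ _ hx).symm.trans (congrArg (β (σ (τ x))) (funext fun l ↦ (hg (v l)).symm))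

end IsAdaptedParametrization

theorem IsHorizontal.pullback {𝕜 : Type*} [RCLike 𝕜] {α : DiffForm m M 𝕜 k}
    (hα : F.IsHorizontal α) {C : Type*} [NormedAddCommGroup C] [NormedSpace ℝ C]
    {σ : EuclideanSpace ℂ (Fin n) × C → M} {τ : M → EuclideanSpace ℂ (Fin n) × C} {i : ι} {x : M}
    (h : F.IsAdaptedParametrization i x σ τ) :
    ∀ᶠ z in nhds (τ x), ∀ (v : Fin k → EuclideanSpace ℂ (Fin n) × C) (j : Fin k),
      (v j).1 = 0 → α.pullback σ z v = 0 := by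
  filter_upwards [h.mem, h.df_mfderiv] with z hz hB v j hj
  obtain ⟨B, hB⟩ := hB
  exact hα.apply_eq_zero hz _ j 
    ((hB (v j)).trans (by rw [hj, map_zero]))

theorem d_mem_basicForms [IsManifold (𝓡 m) ∞ M] {𝕜 : Type*} [RCLike 𝕜] {α : DiffForm m M 𝕜 k}
    (hα : α ∈ F.basicForms 𝕜 k) : α.d ∈ F.basicForms 𝕜 (k + 1) :=
  ⟨hα.1.d, hα.2.2, by rw [hα.1.d_d]; exact fun _ _ _ _ ↦ rfl⟩

variable [IsManifold 𝓘(ℂ, EuclideanSpace ℂ (Fin n)) ω T₀]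

/-- A lift to the tangent space of the transverse complex structure. -/
def transverseJ (F : TransverselyHolomorphicFoliation m n M T₀ ι) (x : M) :
    TangentSpace (𝓡 m) x →L[ℝ] TangentSpace (𝓡 m) x :=
  (F.exists_transverseJ x).choose

theorem df_transverseJ (F : TransverselyHolomorphicFoliation m n M T₀ ι) {i : ι} {x : M}
    (hi : x ∈ F.U i) (v : TangentSpace (𝓡 m) x) :
    F.df i x (F.transverseJ x v) = Complex.I • F.df i x v :=
  (F.exists_transverseJ x).choose_spec i hi v

/-- The component of type `(p, k - p)` of a horizontal form. -/
def typeComponent (F : TransverselyHolomorphicFoliation m n M T₀ ι) (α : DiffForm m M ℂ k) (p : ℕ) :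
    DiffForm m M ℂ k :=
  fun x ↦ ContinuousAlternatingMap.typeComponent (F.transverseJ x) (α x) p

theorem sum_typeComponent (F : TransverselyHolomorphicFoliation m n M T₀ ι)
    (α : DiffForm m M ℂ k) : ∑ p ∈ Finset.range (k + 1), F.typeComponent α p = α := by
  funext x
  refine Eq.trans ?_ (ContinuousAlternatingMap.sum_typeComponent (F.transverseJ x) (α x))
  exact Finset.sum_apply x (Finset.range (k + 1))
    (fun p ↦ (F.typeComponent α p : (x : M) → TangentSpace (𝓡 m) x [⋀^Fin k]→L[ℝ] ℂ))

theorem IsHorizontal.typeComponent {α : DiffForm m M ℂ k} (hα : F.IsHorizontal α) (p : ℕ) :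
    F.IsHorizontal (F.typeComponent α p) := by
  intro x v j hv
  obtain ⟨i, hi⟩ := F.exists_mem x
  exact ContinuousAlternatingMap.typeComponent_horizontal (N := (F.df i x).toLinearMap)
    (F.df_transverseJ hi) (hα.apply_eq_zero hi) p v j (hv i hi)

/-- A component of a horizontal form depends on the lift `J` only modulo vectors tangent to the
leaves. The possibly discontinuous `transverseJ` can thus be replaced by the constant `fstJ`, and
taking components becomes one fixed linear operator. -/
theorem IsHorizontal.pullback_typeComponent {α : DiffForm m M ℂ k} (hα : F.IsHorizontal α) (p : ℕ)
    {C : Type*} [NormedAddCommGroup C] [NormedSpace ℝ C]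
    {σ : EuclideanSpace ℂ (Fin n) × C → M} {τ : M → EuclideanSpace ℂ (Fin n) × C} {i : ι} {x : M}
    (h : F.IsAdaptedParametrization i x σ τ) :
    ∀ᶠ z in nhds (τ x), (F.typeComponent α p).pullback σ z =
      typeComponentCLM (fstJ n C) k p (α.pullback σ z) := by
  filter_upwards [h.mem, h.df_mfderiv] with z hz hB
  obtain ⟨B, hB⟩ := hB
  ext v
  rw [typeComponentCLM_apply, ContinuousAlternatingMap.typeComponent_apply,
    DiffForm.pullback_apply]
  refine (ContinuousAlternatingMap.typeComponent_apply _ _ _ _).trans ?_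
  refine Finset.sum_congr rfl fun j _ ↦ ?_
  congr 1
  rw [DiffForm.pullback_apply]
  refine ContinuousAlternatingMap.eq_of_horizontal (N := F.df i (σ z)) (map_sub _)
    (hα.apply_eq_zero hz) fun l ↦ ?_
  rw [map_add, map_smul, F.df_transverseJ hz, hB, hB]
  have h₁ : (v l + (j : ℝ) • fstJ n C (v l)).1 = (v l).1 + (j : ℝ) • Complex.I • (v l).1 := rfl
  rw [h₁, map_add, ← Complex.coe_smul, ← Complex.coe_smul, map_smul, map_smul]

theorem typeComponent_add (F : TransverselyHolomorphicFoliation m n M T₀ ι)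
    (α β : DiffForm m M ℂ k) (p : ℕ) :
    F.typeComponent (α + β) p = F.typeComponent α p + F.typeComponent β p := by
  funext x
  ext v
  refine (ContinuousAlternatingMap.typeComponent_apply _ _ _ _).trans (Eq.trans ?_
    (congrArg₂ (· + ·) (ContinuousAlternatingMap.typeComponent_apply _ (α x) p v)
      (ContinuousAlternatingMap.typeComponent_apply _ (β x) p v)).symm)
  simp only [← Finset.sum_add_distrib, ← mul_add]
  rfl

/-- `TransverselyHolomorphicFoliation.typeComponent` as an additive map. -/
def typeComponentHom (F : TransverselyHolomorphicFoliation m n M T₀ ι) (k p : ℕ) :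
    DiffForm m M ℂ k →+ DiffForm m M ℂ k :=
  AddMonoidHom.mk' (fun α ↦ F.typeComponent α p) fun α β ↦ F.typeComponent_add α β p

/-- This gives uniqueness of the type decomposition: identities between forms can be compared type
by type. -/
theorem typeComponentHom_of_mem {α : DiffForm m M ℂ k} {p q r : ℕ}
    (hα : α ∈ F.typeForms k p q) (hpq : p + q = k) (hr : r ≤ k) :
    F.typeComponentHom k r α = if r = p then α else 0 := by
  funext x
  ext v
  obtain ⟨i, hi⟩ := F.exists_mem x
  have hp : p ∈ Finset.range (k + 1) := by simp; omega
  have h : ContinuousAlternatingMap.typeComponent (F.transverseJ x) (α x) r v =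
      if r = p then α x v else 0 := by
    refine ContinuousAlternatingMap.typeComponent_eq (b := fun s ↦ if s = p then α x v else 0)
      (fun c ↦ ?_) hr
    rw [hα.2 i x hi c v _ fun l ↦ ContinuousAlternatingMap.map_lift
      (N := (F.df i x).toLinearMap) (F.df_transverseJ hi) c (v l)]
    simp only [ite_mul, zero_mul, Finset.sum_ite_eq', hp, if_true]
    rw [show k - p = q by omega]
    ring
  refine h.trans ?_
  split_ifs <;> rfl

theorem typeComponentHom_of_mem_self {α : DiffForm m M ℂ k} {p q : ℕ}
    (hα : α ∈ F.typeForms k p q) (hpq : p + q = k) : F.typeComponentHom k p α = α := by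
  rw [typeComponentHom_of_mem hα hpq (by omega), if_pos rfl]

theorem typeComponentHom_of_mem_of_ne {α : DiffForm m M ℂ k} {p q r : ℕ}
    (hα : α ∈ F.typeForms k p q) (hpq : p + q = k) (hr : r ≤ k) (hrp : r ≠ p) :
    F.typeComponentHom k r α = 0 := by
  rw [typeComponentHom_of_mem hα hpq hr, if_neg hrp]

variable [IsManifold (𝓡 m) ∞ M]

/-- The components of a basic form are basic forms of pure type. -/
theorem typeComponent_mem_typeForms {α : DiffForm m M ℂ k} (hα : α ∈ F.basicForms ℂ k) {p q : ℕ}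
    (hpq : p + q = k) : F.typeComponent α p ∈ F.typeForms k p q := by
  obtain ⟨hs, hh, hd⟩ := hα
  have hs' : (F.typeComponent α p).IsSmooth := by
    refine DiffForm.isSmooth_of_pullback fun x ↦ ?_
    obtain ⟨i, hi⟩ := F.exists_mem x
    obtain ⟨C, _, _, σ, τ, h⟩ := F.exists_isAdaptedParametrization hi
    refine ⟨_, inferInstance, inferInstance, σ, τ, h.contMDiffAt_inv, h.contMDiffAt,
      h.right_inv, ?_⟩
    refine ContDiffAt.congr_of_eventuallyEq ?_ (hh.pullback_typeComponent p h)
    exact (typeComponentCLM (fstJ n C) k p).contDiff.contDiffAt.comp _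
      (hs.contDiffAt_pullback h.contMDiffAt.self_of_nhds)
  refine ⟨⟨hs', hh.typeComponent p, fun x v j hv ↦ ?_⟩, fun i x hi c v w hvw ↦ ?_⟩
  · obtain ⟨i, hi⟩ := F.exists_mem x
    obtain ⟨C, _, _, σ, τ, h⟩ := F.exists_isAdaptedParametrization hi
    have hσ := h.contMDiffAt.self_of_nhds
    have hA := (hs.contDiffAt_pullback hσ).differentiableAt (by simp)
    have hA' := (hs'.contDiffAt_pullback hσ).differentiableAt (by simp)
    obtain ⟨ξ, hξ, hpb⟩ := h.exists_pullback_eq v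
    rw [hpb, hs'.pullback_d hσ]
    -- It suffices that vertical derivatives vanish. They do for `α`, and a constant operator
    -- commutes with differentiation.
    refine (extDeriv_horizontal_iff (N := Prod.fst) hA' ((hh.typeComponent p).pullback h)).2
      (fun u hu ↦ ?_) ξ j (hξ j (hv i hi))
    rw [Filter.EventuallyEq.fderiv_eq (hh.pullback_typeComponent p h)]
    have h₁ := ((typeComponentCLM (fstJ n C) k p).hasFDerivAt.comp (τ x) hA.hasFDerivAt).fderiv
    have h₂ : fderiv ℝ (α.pullback σ) (τ x) u = 0 := by
      refine (extDeriv_horizontal_iff (N := Prod.fst) hA (hh.pullback h)).1 ?_ u hu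
      have h₃ := (hd.pullback h).self_of_nhds
      rwa [hs.pullback_d hσ] at h₃
    refine (congrArg (fun L : _ →L[ℝ] _ ↦ L u) h₁).trans ?_
    simp [h₂]
  · exact ContinuousAlternatingMap.typeComponent_type (N := (F.df i x).toLinearMap)
      (F.df_transverseJ hi) (hh.apply_eq_zero hi) hpq hvw

theorem typeComponent_d_eq_zero {α : DiffForm m M ℂ k} {p q : ℕ} (hα : α ∈ F.typeForms k p q)
    (hpq : p + q = k) {r : ℕ} (hr : r ≤ k + 1) (hrp : r ≠ p) (hrp' : r ≠ p + 1) :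
    F.typeComponent α.d r = 0 := by
  obtain ⟨⟨hs, hh, hd⟩, ht⟩ := hα
  funext x
  ext v
  obtain ⟨i, hi⟩ := F.exists_mem x
  obtain ⟨C, _, _, σ, τ, h⟩ := F.exists_isAdaptedParametrization hi
  have hσ := h.contMDiffAt.self_of_nhds
  obtain ⟨ξ, -, hpb⟩ := h.exists_pullback_eq v
  rw [hpb, (hd.pullback_typeComponent r h).self_of_nhds, hs.pullback_d hσ, typeComponentCLM_apply,
    typeComponent_extDeriv_eq_zero hpq ((hs.contDiffAt_pullback hσ).differentiableAt (by simp))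
      ?_ hr hrp hrp']
  · rfl
  · filter_upwards [h.mem, h.df_mfderiv] with z hz hB c w
    obtain ⟨B, hB⟩ := hB
    refine ht i (σ z) hz c _ _ fun l ↦ ?_
    have h₁ := ContinuousAlternatingMap.map_lift
      (N := LinearMap.fst ℝ (EuclideanSpace ℂ (Fin n)) C) (J := fstJ n C) fst_fstJ c (w l)
    exact (hB _).trans ((congrArg B h₁).trans ((map_smul B c _).trans
      (congrArg (c • ·) (hB (w l)).symm)))

/-- `d = ∂ + ∂̄` on forms of pure type. -/
theorem exists_d_eq_add {α : DiffForm m M ℂ k} {p q : ℕ} (hα : α ∈ F.typeForms k p q)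
    (hpq : p + q = k) : ∃ η ∈ F.typeForms (k + 1) (p + 1) q,
      ∃ ζ ∈ F.typeForms (k + 1) p (q + 1), α.d = η + ζ := by
  have hd := d_mem_basicForms hα.1
  refine ⟨_, typeComponent_mem_typeForms hd (by omega), _,
    typeComponent_mem_typeForms hd (by omega), ?_⟩
  conv_lhs => rw [← F.sum_typeComponent α.d]
  refine Finset.sum_eq_add_of_mem (p + 1) p (by simp; omega) (by simp; omega) (by omega)
    fun r hr hne ↦ ?_
  exact typeComponent_d_eq_zero hα hpq (Nat.lt_succ_iff.1 (Finset.mem_range.1 hr)) hne.2 hne.1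

end TransverselyHolomorphicFoliation

/-! ### Finite dimensionality modulo a subspace -/

section FiniteModulo

variable {K X : Type*} [Field K] [AddCommGroup X] [Module K X]

/-- Finiteness becomes an inclusion in the ambient space, so that it can be chained; `W` need not
lie in `Z`. -/
theorem finiteDimensional_quotient_submoduleOf_iff {Z W : Submodule K X} :
    FiniteDimensional K (Z ⧸ W.submoduleOf Z) ↔ ∃ S : Submodule K X, S.FG ∧ Z ≤ W ⊔ S := by
  constructor
  · intro h
    obtain ⟨S, hS⟩ := Submodule.exists_isCompl (W.submoduleOf Z)
    have hfin : FiniteDimensional K S :=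
      LinearEquiv.finiteDimensional (Submodule.quotientEquivOfIsCompl _ _ hS)
    refine ⟨S.map Z.subtype, ((Module.Finite.iff_fg).1 hfin).map _, fun z hz ↦ ?_⟩
    have hz' : (⟨z, hz⟩ : Z) ∈ W.submoduleOf Z ⊔ S := by rw [hS.sup_eq_top]; trivial
    obtain ⟨w, hw, s, hs, hws⟩ := Submodule.mem_sup.1 hz'
    refine Submodule.mem_sup.2 ⟨w, hw, s, ⟨s, hs, rfl⟩, ?_⟩
    simpa using congrArg Subtype.val hws
  · rintro ⟨S, hS, hZ⟩
    let f : Z →ₗ[K] X ⧸ W := W.mkQ ∘ₗ Z.subtype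
    have hker : LinearMap.ker f = W.submoduleOf Z := by
      ext z
      simp [f, Submodule.submoduleOf]
    have : FiniteDimensional K S := Module.Finite.iff_fg.2 hS
    have hrange : LinearMap.range f ≤ S.map W.mkQ := by
      rintro _ ⟨z, rfl⟩
      obtain ⟨w, hw, s, hs, hws⟩ := Submodule.mem_sup.1 (hZ z.2)
      refine ⟨s, hs, ?_⟩
      simp only [f, LinearMap.comp_apply, Submodule.subtype_apply, ← hws, map_add]
      simp [hw]
    have := Submodule.finiteDimensional_of_le hrange
    exact LinearEquiv.finiteDimensional
      ((Submodule.quotEquivOfEq _ _ hker.symm).trans f.quotKerEquivRange).symm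

/-- `S` need not lie in `Z`, so it cannot simply be kept; but `Z / (Z ⊓ W)` embeds in the quotient
by `W`, where the image of `Z` is finite dimensional. -/
theorem exists_fg_le_inf_sup {Z W S : Submodule K X} (hS : S.FG) (h : Z ≤ W ⊔ S) :
    ∃ T : Submodule K X, T.FG ∧ Z ≤ (Z ⊓ W) ⊔ T := by
  rw [← finiteDimensional_quotient_submoduleOf_iff]
  have h₁ : (Z ⊓ W).submoduleOf Z = W.submoduleOf Z := by
    ext z
    simp [Submodule.submoduleOf]
  rw [h₁]
  exact finiteDimensional_quotient_submoduleOf_iff.2 ⟨S, hS, h⟩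

theorem exists_fg_iSup_le {ι : Type*} [Finite ι] {Z W : ι → Submodule K X}
    (h : ∀ i, FiniteDimensional K (Z i ⧸ (W i).submoduleOf (Z i))) :
    ∃ S : Submodule K X, S.FG ∧ ⨆ i, Z i ≤ (⨆ i, W i) ⊔ S := by
  choose S hS hZ using fun i ↦ finiteDimensional_quotient_submoduleOf_iff.1 (h i)
  refine ⟨⨆ i, S i, Submodule.fg_iSup S hS, iSup_le fun i ↦ (hZ i).trans ?_⟩
  exact sup_le_sup (le_iSup W i) (le_iSup S i)

end FiniteModulo

namespace DiffForm

variable {m : ℕ} {M : Type*} [TopologicalSpace M] [ChartedSpace (EuclideanSpace ℝ (Fin m)) M]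
  {𝕜 : Type*} [RCLike 𝕜] {k : ℕ}

theorem isSmooth_sum {ι : Type*} (s : Finset ι) {α : ι → DiffForm m M 𝕜 k}
    (h : ∀ i ∈ s, (α i).IsSmooth) : (∑ i ∈ s, α i).IsSmooth := by
  classical
  induction s using Finset.induction_on with
  | empty => exact isSmooth_zero
  | insert i s hi ih =>
    rw [Finset.sum_insert hi]
    exact (h i (by simp)).add (ih fun j hj ↦ h j (by simp [hj]))

theorem d_sum {ι : Type*} (s : Finset ι) {α : ι → DiffForm m M 𝕜 k}
    (h : ∀ i ∈ s, (α i).IsSmooth) : (∑ i ∈ s, α i).d = ∑ i ∈ s, (α i).d := by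
  classical
  induction s using Finset.induction_on with
  | empty => exact d_zero
  | insert i s hi ih =>
    rw [Finset.sum_insert hi, Finset.sum_insert hi, d_add (h i (by simp))
      (isSmooth_sum s fun j hj ↦ h j (by simp [hj])), ih fun j hj ↦ h j (by simp [hj])]

end DiffForm

/-! ### Comparison of de Rham, Bott–Chern and Aeppli cohomology -/

namespace TransverselyHolomorphicFoliation

variable {m n : ℕ} {M T₀ ι : Type*}
  [TopologicalSpace M] [ChartedSpace (EuclideanSpace ℝ (Fin m)) M]
  [TopologicalSpace T₀] [ChartedSpace (EuclideanSpace ℂ (Fin n)) T₀]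
  {F : TransverselyHolomorphicFoliation m n M T₀ ι} {k : ℕ}

/-- Since `∂α = dα - ∂̄α`, images of `∂` are images of `∂̄` modulo exact forms. The index `r`
records the type `(r, k - r)` of the source. -/
theorem imDel_sup_imDelbar_le (F : TransverselyHolomorphicFoliation m n M T₀ ι) {k p q : ℕ}
    (hpq : p + q = k + 1) : F.imDel (k + 1) p q ⊔ F.imDelbar (k + 1) p q ≤
      F.exactForms ℂ (k + 1) ⊔ ⨆ r : Fin (k + 1), graphIm (F.delbarGraph k r (k - r)) := by
  refine sup_le ?_ ?_
  · cases p with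
    | zero => exact bot_le
    | succ p =>
      rintro _ ⟨⟨α, η⟩, ⟨h₁, h₂, h₃⟩, rfl⟩
      have h₄ : α.d - η ∈ ⨆ r : Fin (k + 1), graphIm (F.delbarGraph k r (k - r)) := by
        refine Submodule.mem_iSup_of_mem ⟨p, by omega⟩ ⟨(α, α.d - η), ?_, rfl⟩
        have hq : k - p = q := by omega
        simp only [hq]
        exact ⟨h₁, h₃, by simpa using h₂⟩
      refine Submodule.mem_sup.2 ⟨α.d, ⟨α, h₁.1, rfl⟩, _, neg_mem h₄, ?_⟩
      simp
  · cases q with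
    | zero => exact bot_le
    | succ q =>
      refine le_sup_of_le_right (le_iSup_of_le ⟨p, by omega⟩ ?_)
      have hq : k - p = q := by omega
      simp only [hq]
      exact le_rfl

variable [IsManifold (𝓡 m) ∞ M] [IsManifold 𝓘(ℂ, EuclideanSpace ℂ (Fin n)) ω T₀]

/-- `d∂α = ∂̄∂α` and `d∂̄α = ∂∂̄α`, both of type `(p + 1, q + 1)`, and `∂̄∂α = -∂∂̄α`. -/
theorem d_del_mem {α : DiffForm m M ℂ k} {η ζ : DiffForm m M ℂ (k + 1)} {p q : ℕ}
    (hpq : p + q = k) (hα : α ∈ F.typeForms k p q) (hη : η ∈ F.typeForms (k + 1) (p + 1) q)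
    (hζ : ζ ∈ F.typeForms (k + 1) p (q + 1)) (h : α.d = η + ζ) :
    η.d ∈ F.typeForms (k + 2) (p + 1) (q + 1) ∧ ζ.d ∈ F.typeForms (k + 2) (p + 1) (q + 1) ∧
      η.d + ζ.d = 0 := by
  have h₀ : η.d + ζ.d = 0 := by
    rw [← DiffForm.d_add hη.1.1 hζ.1.1, ← h, hα.1.1.d_d]
  obtain ⟨η₁, hη₁, η₂, hη₂, hη'⟩ := exists_d_eq_add hη (by omega)
  obtain ⟨ζ₁, hζ₁, ζ₂, hζ₂, hζ'⟩ := exists_d_eq_add hζ (by omega)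
  -- `η₁ = ∂∂α` is the only contribution of type `(p + 2, q)` to `ddα = 0`.
  have h₁ : η₁ = 0 := by
    have := congrArg (F.typeComponentHom (k + 2) (p + 2)) h₀
    rw [hη', hζ', map_add, map_add, map_add, map_zero,
      typeComponentHom_of_mem_self hη₁ (by omega),
      typeComponentHom_of_mem_of_ne hη₂ (by omega) (by omega) (by omega),
      typeComponentHom_of_mem_of_ne hζ₁ (by omega) (by omega) (by omega),
      typeComponentHom_of_mem_of_ne hζ₂ (by omega) (by omega) (by omega)] at this
    simpa using this
  rw [h₁, zero_add] at hη'
  have h₂ : η.d ∈ F.typeForms (k + 2) (p + 1) (q + 1) := hη' ▸ hη₂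
  exact ⟨h₂, (eq_neg_of_add_eq_zero_right h₀) ▸ neg_mem h₂, h₀⟩

/-- The components of a closed basic form are Aeppli cocycles. -/
theorem closedForms_le_iSup_aeppliCocycles (F : TransverselyHolomorphicFoliation m n M T₀ ι)
    (k : ℕ) : F.closedForms ℂ k ≤ ⨆ r : Fin (k + 1), F.aeppliCocycles k r (k - r) := by
  rintro α ⟨hα, hd⟩
  have hβ (r : ℕ) (hr : r ≤ k) : F.typeComponent α r ∈ F.typeForms k r (k - r) :=
    typeComponent_mem_typeForms hα (by omega)
  -- The condition `r ≤ k` sits inside the existential so that `η` and `ζ` can be chosen as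
  -- functions on all of `ℕ`.
  have hex (r : ℕ) : ∃ η ζ, r ≤ k → η ∈ F.typeForms (k + 1) (r + 1) (k - r) ∧
      ζ ∈ F.typeForms (k + 1) r (k - r + 1) ∧ (F.typeComponent α r).d = η + ζ := by
    by_cases hr : r ≤ k
    · obtain ⟨η, hη, ζ, hζ, h⟩ := exists_d_eq_add (hβ r hr) (by omega)
      exact ⟨η, ζ, fun _ ↦ ⟨hη, hζ, h⟩⟩
    · exact ⟨0, 0, fun h ↦ absurd h hr⟩
  choose η ζ hηζ using hex
  have hsum : ∑ r ∈ Finset.range (k + 1), (η r + ζ r) = 0 := by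
    rw [← hd]
    conv_rhs => rw [← F.sum_typeComponent α]
    rw [DiffForm.d_sum _ fun r hr ↦ (hβ r (Nat.lt_succ_iff.1 (Finset.mem_range.1 hr))).1.1]
    exact Finset.sum_congr rfl fun r hr ↦
      ((hηζ r (Nat.lt_succ_iff.1 (Finset.mem_range.1 hr))).2.2).symm
  -- The part of `dα = 0` of type `(s, k + 1 - s)`: `∂α_{s-1} + ∂̄α_s = 0`. For `s = 0` the sum is
  -- empty, so no index `s - 1` is needed.
  have hcomp (s : ℕ) (hs : s ≤ k) : (∑ r ∈ Finset.range (k + 1), if s = r + 1 then η r else 0) +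
      ζ s = 0 := by
    have h₁ := congrArg (F.typeComponentHom (k + 1) s) hsum
    rw [map_zero, map_sum] at h₁
    have h₂ : ∀ r ∈ Finset.range (k + 1), F.typeComponentHom (k + 1) s (η r + ζ r) =
        (if s = r + 1 then η r else 0) + if s = r then ζ r else 0 := fun r hr ↦ by
      have hr' : r ≤ k := Nat.lt_succ_iff.1 (Finset.mem_range.1 hr)
      rw [map_add, typeComponentHom_of_mem (hηζ r hr').1 (by omega) (by omega),
        typeComponentHom_of_mem (hηζ r hr').2.1 (by omega) (by omega)]
    rw [Finset.sum_congr rfl h₂, Finset.sum_add_distrib] at h₁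
    have hs' : s ∈ Finset.range (k + 1) := by simp; omega
    simpa only [Finset.sum_ite_eq, hs', if_true] using h₁
  have hmem (p : ℕ) (hp : p ≤ k) : F.typeComponent α p ∈ F.aeppliCocycles k p (k - p) := by
    obtain ⟨h₁, h₂, h₃⟩ := hηζ p hp
    refine ⟨ζ p, ⟨hβ p hp, h₂, ?_⟩, h₂, zero_mem _, ?_⟩
    · rw [LinearMap.inl_apply, h₃, add_sub_cancel_right]
      exact h₁
    · rw [LinearMap.inl_apply, sub_zero]
      have h₄ := hcomp p hp
      cases p with
      | zero =>
        have h₅ : ζ 0 = 0 := by simpa using h₄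
        simp only [h₅, DiffForm.d_zero]
        exact zero_mem _
      | succ p =>
        obtain ⟨h₅, h₆, h₇⟩ := hηζ p (by omega)
        obtain ⟨-, h₈, h₉⟩ := d_del_mem (by omega) (hβ p (by omega)) h₅ h₆ h₇
        have hp' : p ∈ Finset.range (k + 1) := by simp; omega
        simp only [Nat.add_right_cancel_iff, Finset.sum_ite_eq, hp', if_true] at h₄
        have h₁₀ : (η p).d + (ζ (p + 1)).d = 0 := by
          rw [← DiffForm.d_add h₅.1.1 h₂.1.1, h₄, DiffForm.d_zero]
        -- Both forms equal `-d∂α_p`. The right-hand side has type `(p + 1, k - p + 1)`, which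
        -- leaves `0` as an admissible value of `∂∂̄α_{p+1}`.
        have h₁₁ : (ζ (p + 1)).d = (ζ p).d := add_left_cancel (h₁₀.trans h₉.symm)
        simp only [h₁₁]
        rwa [show k - p = k - (p + 1) + 1 by omega] at h₈
  rw [← F.sum_typeComponent α]
  refine sum_mem fun p hp ↦ ?_
  have hp' := Finset.mem_range.1 hp
  exact Submodule.mem_iSup_of_mem ⟨p, hp'⟩ (hmem p (by omega))

theorem closedForms_inf_le (F : TransverselyHolomorphicFoliation m n M T₀ ι) (k : ℕ) :
    F.closedForms ℂ k ⊓ (⨆ r : Fin (k + 1), F.imDel k r (k - r) ⊔ F.imDelbar k r (k - r)) ≤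
      F.exactForms ℂ k ⊔ ⨆ r : Fin (k + 1), F.bottChernCocycles k r (k - r) := by
  cases k with
  | zero =>
    refine inf_le_right.trans (iSup_le fun r ↦ sup_le ?_ ?_)
    · exact bot_le
    · exact bot_le
  | succ k =>
    rintro α ⟨⟨hα, hd⟩, h⟩
    have h₁ := iSup_le (fun r : Fin (k + 1 + 1) ↦
      F.imDel_sup_imDelbar_le (k := k) (p := r) (q := k + 1 - r) (by omega)) h
    obtain ⟨_, ⟨γ, hγ, rfl⟩, δ, hδ, rfl⟩ := Submodule.mem_sup.1 h₁
    refine add_mem (Submodule.mem_sup_left ⟨γ, hγ, rfl⟩) (Submodule.mem_sup_right ?_)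
    obtain ⟨ε, hε, hδε⟩ := (Submodule.mem_iSup_iff_exists_finsupp _ _).1 hδ
    rw [Finsupp.sum_fintype _ _ fun _ ↦ rfl] at hδε
    subst hδε
    have hε' (r : Fin (k + 1)) : ε r ∈ F.typeForms (k + 1) r (k - r + 1) ∧
        (ε r).d ∈ F.typeForms (k + 2) (r + 1) (k - r + 1) := by
      obtain ⟨⟨a, ζ⟩, ⟨h₁, h₂, h₃⟩, h₄⟩ := hε r
      rw [← h₄]
      exact ⟨h₂, (d_del_mem (by omega) h₁ h₃ h₂ (by simp)).2.1⟩
    have hsm : ∀ r ∈ Finset.univ, (ε r).IsSmooth := fun r _ ↦ (hε' r).1.1.1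
    have hd' : ∑ r, (ε r).d = 0 := by
      rw [DiffForm.d_add hγ.1.d (DiffForm.isSmooth_sum _ hsm), hγ.1.d_d, zero_add,
        DiffForm.d_sum _ hsm] at hd
      exact hd
    refine sum_mem fun r _ ↦ ?_
    -- The forms `(ε s).d` have first degree `s + 1`, different for different `s`; projecting their
    -- vanishing sum isolates one of them.
    have hdr : (ε r).d = 0 := by
      have h₁ := congrArg (F.typeComponentHom (k + 2) (r + 1)) hd'
      rw [map_zero, map_sum] at h₁
      have h₂ : ∀ s ∈ Finset.univ, F.typeComponentHom (k + 2) (r + 1) (ε s).d =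
          if r = s then (ε s).d else 0 := fun s _ ↦ by
        rw [typeComponentHom_of_mem (hε' s).2 (by omega) (by omega)]
        simp [Fin.ext_iff]
      rw [Finset.sum_congr rfl h₂] at h₁
      simpa using h₁
    refine Submodule.mem_iSup_of_mem (r.castSucc) ?_
    have hr : k + 1 - (r.castSucc : ℕ) = k - r + 1 := by simp; omega
    rw [hr]
    refine ⟨⟨(hε' r).1, zero_mem _, ?_⟩, (hε' r).1, zero_mem _, ?_⟩
    · simp [hdr, zero_mem]
    · simp [hdr, zero_mem]

theorem imDelDelbar_le_exactForms (F : TransverselyHolomorphicFoliation m n M T₀ ι) {k p q : ℕ}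
    (hpq : p + q = k) : F.imDelDelbar k p q ≤ F.exactForms ℂ k := by
  match k, p, q, hpq with
  | 0, _, _, _ => exact bot_le
  | 1, _, _, _ => exact bot_le
  | k + 2, 0, _, _ => exact bot_le
  | k + 2, p + 1, 0, _ => exact bot_le
  | k + 2, p + 1, q + 1, hpq =>
    rintro _ ⟨⟨α, η⟩, ⟨ζ, ⟨h₁, h₂, h₃⟩, -, h₄, h₅⟩, rfl⟩
    have h₆ := (d_del_mem (by omega) h₁ h₃ h₂ (by simp)).2.1
    refine ⟨ζ, h₂.1, ?_⟩
    -- `ζ.d - η` has type `(p + 1, q + 1)` as a difference of such forms and type `(p, q + 2)` by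
    -- the definition of `∂`, so it is zero.
    have h₇ := typeComponentHom_of_mem_self (sub_mem h₆ h₄) (by omega)
    rw [typeComponentHom_of_mem_of_ne h₅ (by omega) (by omega) (by omega)] at h₇
    exact (sub_eq_zero.1 h₇.symm)

/-- If the basic Bott–Chern and Aeppli cohomologies of total degree `k` are finite dimensional,
then so is the complex basic cohomology of degree `k`. -/
theorem finiteDimensional_basicCohomology_complex (F : TransverselyHolomorphicFoliation m n M T₀ ι)
    (k : ℕ)
    (hBC : ∀ p q, p + q = k → FiniteDimensional ℂ (F.BottChernCohomology p q))
    (hA : ∀ p q, p + q = k → FiniteDimensional ℂ (F.AeppliCohomology p q)) :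
    FiniteDimensional ℂ (F.BasicCohomology ℂ k) := by
  have hBC' (r : Fin (k + 1)) : FiniteDimensional ℂ (F.bottChernCocycles k r (k - r) ⧸
      (F.imDelDelbar k r (k - r)).submoduleOf (F.bottChernCocycles k r (k - r))) := by
    have h : (r : ℕ) + (k - r) = k := by omega
    have := hBC r (k - r) h
    unfold BottChernCohomology at this
    rwa [h] at this
  have hA' (r : Fin (k + 1)) : FiniteDimensional ℂ (F.aeppliCocycles k r (k - r) ⧸
      (F.imDel k r (k - r) ⊔ F.imDelbar k r (k - r)).submoduleOf
        (F.aeppliCocycles k r (k - r))) := by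
    have h : (r : ℕ) + (k - r) = k := by omega
    have := hA r (k - r) h
    unfold AeppliCohomology at this
    rwa [h] at this
  obtain ⟨S, hS, hBCS⟩ := exists_fg_iSup_le hBC'
  obtain ⟨T, hT, hAT⟩ := exists_fg_iSup_le hA'
  obtain ⟨T', hT', h₁⟩ := exists_fg_le_inf_sup hT
    ((F.closedForms_le_iSup_aeppliCocycles k).trans hAT)
  -- Modulo `T'`, which comes from Aeppli cohomology, closed forms are exact forms plus Bott–Chern
  -- cocycles; the latter are exact modulo `S`.
  refine finiteDimensional_quotient_submoduleOf_iff.2 ⟨S ⊔ T', hS.sup hT', h₁.trans ?_⟩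
  rw [← sup_assoc]
  refine sup_le_sup_right ((F.closedForms_inf_le k).trans (sup_le le_sup_left (hBCS.trans ?_))) _
  exact sup_le_sup_right (iSup_le fun r ↦ F.imDelDelbar_le_exactForms (by omega)) _

end TransverselyHolomorphicFoliation

/-! ### Change of coefficients -/

namespace DiffForm

variable {m : ℕ} {M : Type*} [TopologicalSpace M] [ChartedSpace (EuclideanSpace ℝ (Fin m)) M]
  {𝕜 𝕜' : Type*} [RCLike 𝕜] [RCLike 𝕜'] {k : ℕ}

/-- The form obtained by applying a real linear map to the values of a form. -/
def mapCoeff (L : 𝕜 →L[ℝ] 𝕜') (α : DiffForm m M 𝕜 k) : DiffForm m M 𝕜' k :=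
  fun x ↦ L.compContinuousAlternatingMap (α x)

theorem mapCoeff_apply (L : 𝕜 →L[ℝ] 𝕜') (α : DiffForm m M 𝕜 k) (x : M)
    (v : Fin k → TangentSpace (𝓡 m) x) : mapCoeff L α x v = L (α x v) := rfl

theorem mapCoeff_add (L : 𝕜 →L[ℝ] 𝕜') (α β : DiffForm m M 𝕜 k) :
    mapCoeff L (α + β) = mapCoeff L α + mapCoeff L β := by
  funext x
  ext v
  exact map_add L (α x v) (β x v)

theorem mapCoeff_zero (L : 𝕜 →L[ℝ] 𝕜') : mapCoeff L (0 : DiffForm m M 𝕜 k) = 0 := by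
  funext x
  ext v
  exact map_zero L

theorem inChart_mapCoeff (L : 𝕜 →L[ℝ] 𝕜') (α : DiffForm m M 𝕜 k) (x : M) :
    (mapCoeff L α).inChart x = (ContinuousLinearMap.compContinuousAlternatingMapCLM ℝ
      (EuclideanSpace ℝ (Fin m)) 𝕜 𝕜' (Fin k) L) ∘ α.inChart x := rfl

theorem IsSmooth.mapCoeff {α : DiffForm m M 𝕜 k} (h : α.IsSmooth) (L : 𝕜 →L[ℝ] 𝕜') :
    (mapCoeff L α).IsSmooth := fun x ↦ by
  rw [inChart_mapCoeff]
  exact (ContinuousLinearMap.contDiff _).comp_contDiffOn (h x)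

theorem IsSmooth.d_mapCoeff {α : DiffForm m M 𝕜 k} (h : α.IsSmooth) (L : 𝕜 →L[ℝ] 𝕜') :
    (DiffForm.mapCoeff L α).d = DiffForm.mapCoeff L α.d := by
  have key (x : M) : extDeriv ((DiffForm.mapCoeff L α).inChart x) (extChartAt (𝓡 m) x x) =
      L.compContinuousAlternatingMap (extDeriv (α.inChart x) (extChartAt (𝓡 m) x x)) := by
    ext v
    rw [inChart_mapCoeff, extDeriv, ((ContinuousLinearMap.hasFDerivAt _).comp _
      (h.differentiableAt x).hasFDerivAt).fderiv]
    simp only [extDeriv, ContinuousAlternatingMap.alternatizeUncurryFin_apply,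
      ContinuousLinearMap.compContinuousAlternatingMap_coe, Function.comp_apply, map_sum,
      map_zsmul]
    rfl
  funext x
  simp only [DiffForm.d, key]
  rfl

/-- For real coefficients this says that the real part undoes the inclusion into `ℂ`; it makes
`𝕜`-cohomology a retract. -/
theorem mapCoeff_map_map (α : DiffForm m M 𝕜 k) :
    mapCoeff (RCLike.map ℂ 𝕜) (mapCoeff (RCLike.map 𝕜 ℂ) α) = α := by
  funext x
  ext v
  rw [mapCoeff_apply, mapCoeff_apply]
  generalize α x v = a
  simp [RCLike.map_apply]

theorem mapCoeff_smul (L : ℂ →L[ℝ] 𝕜) (c : ℂ) (α : DiffForm m M ℂ k) :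
    mapCoeff L (c • α) = (c.re : 𝕜) • mapCoeff L α +
      (c.im : 𝕜) • mapCoeff L (Complex.I • α) := by
  funext x
  ext v
  change L (c * α x v) = (c.re : 𝕜) * L (α x v) + (c.im : 𝕜) * L (Complex.I * α x v)
  generalize α x v = z
  rw [← RCLike.real_smul_eq_coe_mul, ← RCLike.real_smul_eq_coe_mul, ← map_smul, ← map_smul,
    ← map_add]
  congr 1
  conv_lhs => rw [← Complex.re_add_im c]
  simp only [Complex.real_smul]
  ring

end DiffForm

namespace TransverselyHolomorphicFoliation

variable {m n : ℕ} {M T₀ ι : Type*}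
  [TopologicalSpace M] [ChartedSpace (EuclideanSpace ℝ (Fin m)) M]
  [TopologicalSpace T₀] [ChartedSpace (EuclideanSpace ℂ (Fin n)) T₀]
  {F : TransverselyHolomorphicFoliation m n M T₀ ι}
  {𝕜 𝕜' : Type*} [RCLike 𝕜] [RCLike 𝕜'] {k : ℕ}

theorem IsHorizontal.mapCoeff {α : DiffForm m M 𝕜 k} (h : F.IsHorizontal α) (L : 𝕜 →L[ℝ] 𝕜') :
    F.IsHorizontal (α.mapCoeff L) := fun x v j hv ↦ by
  rw [DiffForm.mapCoeff_apply, h x v j hv, map_zero]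

theorem mapCoeff_mem_basicForms {α : DiffForm m M 𝕜 k} (h : α ∈ F.basicForms 𝕜 k)
    (L : 𝕜 →L[ℝ] 𝕜') : α.mapCoeff L ∈ F.basicForms 𝕜' k :=
  ⟨h.1.mapCoeff L, h.2.1.mapCoeff L, by rw [h.1.d_mapCoeff]; exact h.2.2.mapCoeff L⟩

theorem mapCoeff_mem_closedForms {α : DiffForm m M 𝕜 k} (h : α ∈ F.closedForms 𝕜 k)
    (L : 𝕜 →L[ℝ] 𝕜') : α.mapCoeff L ∈ F.closedForms 𝕜' k :=
  ⟨mapCoeff_mem_basicForms h.1 L, by rw [h.1.1.d_mapCoeff, h.2, DiffForm.mapCoeff_zero]⟩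

theorem mapCoeff_mem_exactForms {α : DiffForm m M 𝕜 k} (h : α ∈ F.exactForms 𝕜 k)
    (L : 𝕜 →L[ℝ] 𝕜') : α.mapCoeff L ∈ F.exactForms 𝕜' k := by
  cases k with
  | zero =>
    have h₀ : α = 0 := h
    rw [h₀, DiffForm.mapCoeff_zero]
    exact zero_mem _
  | succ k =>
    obtain ⟨β, hβ, rfl⟩ := h
    exact ⟨β.mapCoeff L, mapCoeff_mem_basicForms hβ L, hβ.1.d_mapCoeff L⟩

/-- Basic cohomology with real coefficients is a retract of basic cohomology with complex
coefficients, so its dimension is finite if the complex one is. -/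
theorem finiteDimensional_basicCohomology_of_complex
    (h : FiniteDimensional ℂ (F.BasicCohomology ℂ k)) (𝕜 : Type*) [RCLike 𝕜] :
    FiniteDimensional 𝕜 (F.BasicCohomology 𝕜 k) := by
  obtain ⟨S, ⟨t, ht⟩, hS⟩ := finiteDimensional_quotient_submoduleOf_iff.1 h
  let ρ : DiffForm m M ℂ k → DiffForm m M 𝕜 k := DiffForm.mapCoeff (RCLike.map ℂ 𝕜)
  -- `ρ` is only real linear, so each complex generator `s` contributes the images of both `s` and
  -- `I • s`.
  let u : Set (DiffForm m M 𝕜 k) := ρ '' t ∪ (fun s ↦ ρ (Complex.I • s)) '' t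
  have hu : u.Finite := (t.finite_toSet.image _).union (t.finite_toSet.image _)
  -- Quantifying over `c` strengthens the induction hypothesis enough to absorb complex scalars,
  -- with which `ρ` does not commute.
  have hρ : ∀ s ∈ S, ∀ c : ℂ, ρ (c • s) ∈ Submodule.span 𝕜 u := by
    rw [← ht]
    intro s hs
    induction hs using Submodule.span_induction with
    | mem s hs =>
      intro c
      simp only [ρ, DiffForm.mapCoeff_smul _ c s]
      exact add_mem (Submodule.smul_mem _ _ (Submodule.subset_span (.inl ⟨s, hs, rfl⟩)))
        (Submodule.smul_mem _ _ (Submodule.subset_span (.inr ⟨s, hs, rfl⟩)))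
    | zero =>
      intro c
      rw [smul_zero]
      simp only [ρ, DiffForm.mapCoeff_zero]
      exact zero_mem _
    | add s s' _ _ hs hs' =>
      intro c
      rw [smul_add]
      simp only [ρ, DiffForm.mapCoeff_add]
      exact add_mem (hs c) (hs' c)
    | smul a s _ hs =>
      intro c
      rw [smul_smul]
      exact hs _
  refine finiteDimensional_quotient_submoduleOf_iff.2
    ⟨Submodule.span 𝕜 u, Submodule.fg_span hu, fun α hα ↦ ?_⟩
  obtain ⟨e, he, s, hs, hes⟩ :=
    Submodule.mem_sup.1 (hS (mapCoeff_mem_closedForms hα (RCLike.map 𝕜 ℂ)))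
  refine Submodule.mem_sup.2 ⟨ρ e, mapCoeff_mem_exactForms he _, ρ s, ?_, ?_⟩
  · simpa using hρ s hs 1
  · rw [← DiffForm.mapCoeff_add, hes, DiffForm.mapCoeff_map_map]

end TransverselyHolomorphicFoliation

end

theorem corollary1 {m n : ℕ} {M T₀ ι : Type*}
    [TopologicalSpace M] [ChartedSpace (EuclideanSpace ℝ (Fin m)) M] [IsManifold (𝓡 m) ∞ M]
    [TopologicalSpace T₀] [ChartedSpace (EuclideanSpace ℂ (Fin n)) T₀]
    [IsManifold 𝓘(ℂ, EuclideanSpace ℂ (Fin n)) ω T₀]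
    (F : TransverselyHolomorphicFoliation m n M T₀ ι)
    {𝕜 : Type*} [RCLike 𝕜] (k : ℕ)
    (h : ¬ FiniteDimensional 𝕜 (F.BasicCohomology 𝕜 k)) :
    ∃ p q : ℕ, p + q = k ∧
      (¬ FiniteDimensional ℂ (F.BottChernCohomology p q) ∨
        ¬ FiniteDimensional ℂ (F.AeppliCohomology p q)) := by
  by_contra! hfin
  exact h (TransverselyHolomorphicFoliation.finiteDimensional_basicCohomology_of_complex
    (F.finiteDimensional_basicCohomology_complex k (fun p q hpq ↦ (hfin p q hpq).1)
      fun p q hpq ↦ (hfin p q hpq).2) 𝕜)
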